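/- Let $\mathcal K$ be a locally presentable 2-category (a complete and cocomplete 2-category whose underlying ordinary category is locally presentable), and let $T$ be a 2-monad on $\mathcal K$ with rank, i.e. $T$ preserves $\alpha$-filtered colimits for some regular cardinal $\alpha$. Let $T\text{-}\mathrm{Alg}_s$ be the 2-category of strict $T$-algebras, strict $T$-morphisms and $T$-transformations, and let $T\text{-}\mathrm{Alg}$ be the 2-category of strict $T$-algebras, pseudo $T$-morphisms and $T$-transformations, with inclusion $J\colon T\text{-}\mathrm{Alg}_s\to T\text{-}\mathrm{Alg}$. Equip $T\text{-}\mathrm{Alg}_s$ with the lifted model structure: a strict morphism is a weak equivalence (respectively a fibration) if its underlying morphism in $\mathcal K$ is an equivalence (respectively an isofibration), and it is a cofibration if it has the left lifting property with respect to the trivial fibrations (the fibrations that are weak equivalences). An object is cofibrant if the morphism to it from the initial algebra is a cofibration. For an algebra $A$ let $A'$ denote the value at $A$ of the left 2-adjoint of $J$: a strict algebra with a pseudo $T$-morphism $p\colon A\rightsquigarrow A'$ such that, for every strict algebra $B$, precomposition with $p$ is an isomorphism of categories $T\text{-}\mathrm{Alg}_s(A',B)\cong T\text{-}\mathrm{Alg}(A,JB)$.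 Let $q\colon A'\to A$ be the counit, i.e. the unique strict morphism with $qp=1_A$. The algebra $A$ is called flexible if $q$ has a section in $T\text{-}\mathrm{Alg}_s$, i.e. if there is a strict morphism $r\colon A\to A'$ with $qr=1_A$. Theorem. (i) A strict $T$-algebra is cofibrant in $T\text{-}\mathrm{Alg}_s$ if and only if it is flexible. (ii) For every strict $T$-algebra $A$, the algebra $A'$ exists and is a cofibrant replacement of $A$: $A'$ is cofibrant and $q\colon A'\to A$ is a trivial fibration. (iii) For every object $X$ of $\mathcal K$, the free $T$-algebra on $X$ is flexible. -/

import Mathlib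

open CategoryTheory Bicategory Limits HomotopicalAlgebra

universe w u

/-! ## Locally presentable 2-categories

A 2-category is a strict bicategory `K`; its underlying ordinary category is
the category structure provided by `StrictBicategory.category`. -/

section Presentable

variable {K : Type u} [Bicategory.{w, w} K]

/-- For a 2-cell `c : s ⟶ t` between 1-cells `P ⟶ A`, the functor from `K(X, P)` to the category
of arrows of `K(X, A)` given by whiskering with `c`. -/
def cotensorComparison {P A : K} {s t : P ⟶ A} (c : s ⟶ t) (X : K) :
    (X ⟶ P) ⥤ Arrow (X ⟶ A) where
  obj h := Arrow.mk (h ◁ c)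
  map γ := Arrow.homMk (γ ▷ s) (γ ▷ t) (by simp [whisker_exchange])

/-- For a 2-cell `c : s ⟶ t` between 1-cells `A ⟶ P`, the functor from `K(P, X)` to the category
of arrows of `K(A, X)` given by whiskering with `c`. -/
def tensorComparison {P A : K} {s t : A ⟶ P} (c : s ⟶ t) (X : K) :
    (P ⟶ X) ⥤ Arrow (A ⟶ X) where
  obj h := Arrow.mk (c ▷ h)
  map γ := Arrow.homMk (s ◁ γ) (t ◁ γ) (by simp [whisker_exchange])

/-- A functor is an isomorphism of categories. -/
def IsIsoOfCategories {C D : Type*} [Category* C] [Category* D] (F : C ⥤ D) : Prop :=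
  F.Full ∧ F.Faithful ∧ Function.Bijective F.obj

variable (K)

/-- `K` has cotensors by the arrow category `𝟚`: for every `A` there is an object `𝟚 ⋔ A`
with isomorphisms of categories `K(X, 𝟚 ⋔ A) ≅ K(X, A)^𝟚`, 2-natural in `X`
(so given by whiskering with a universal 2-cell). -/
def HasArrowCotensors : Prop :=
  ∀ A : K, ∃ (P : K) (s t : P ⟶ A) (c : s ⟶ t),
    ∀ X : K, IsIsoOfCategories (cotensorComparison c X)

/-- `K` has tensors by the arrow category `𝟚`: for every `A` there is an object `𝟚 · A`
with isomorphisms of categories `K(𝟚 · A, X) ≅ K(A, X)^𝟚`, 2-natural in `X`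
(so given by whiskering with a universal 2-cell). -/
def HasArrowTensors : Prop :=
  ∀ A : K, ∃ (P : K) (s t : A ⟶ P) (c : s ⟶ t),
    ∀ X : K, IsIsoOfCategories (tensorComparison c X)

/-- A locally presentable 2-category: a complete and cocomplete 2-category whose underlying
ordinary category is locally presentable.
Given completeness and cocompleteness of the underlying category (which are part of local
presentability), `K` is complete and cocomplete as a 2-category exactly when it has tensors and
cotensors by the arrow category. -/
class IsLocallyPresentableTwoCategory [Bicategory.Strict K] : Prop where
  isLocallyPresentable : CategoryTheory.IsLocallyPresentable.{w} K
  hasArrowCotensors : HasArrowCotensors K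
  hasArrowTensors : HasArrowTensors K

instance [Bicategory.Strict K] [IsLocallyPresentableTwoCategory K] : HasInitial K := by
  have := IsLocallyPresentableTwoCategory.isLocallyPresentable (K := K)
  obtain ⟨κ, _, h⟩ := CategoryTheory.IsLocallyPresentable.exists_cardinal.{w} K
  have : HasColimitsOfSize.{w, w} K := h.toHasColimitsOfSize
  have : HasColimitsOfSize.{0, 0} K := hasColimitsOfSizeShrink.{0, 0, w, w} K
  infer_instance

end Presentable

/-! ## 2-monads -/

/-- A 2-monad on a 2-category: a 2-functor `functor`, with 2-natural transformations `η` and `μ`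
satisfying the monad laws. -/
structure TwoMonad (K : Type u) [Bicategory.{w, w} K] [Bicategory.Strict K] where
  functor : StrictPseudofunctor K K
  /-- the unit, as a natural transformation of ordinary functors -/
  η : 𝟭 K ⟶ functor.toFunctor
  /-- the multiplication, as a natural transformation of ordinary functors -/
  μ : functor.toFunctor ⋙ functor.toFunctor ⟶ functor.toFunctor
  /-- compatibility of `η` with 2-cells -/
  η_two : ∀ {X Y : K} {f g : X ⟶ Y} (θ : f ⟶ g),
    θ ▷ η.app Y =
      eqToHom (η.naturality f) ≫ (η.app X ◁ functor.map₂ θ) ≫ eqToHom (η.naturality g).symm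
  /-- compatibility of `μ` with 2-cells -/
  μ_two : ∀ {X Y : K} {f g : X ⟶ Y} (θ : f ⟶ g),
    functor.map₂ (functor.map₂ θ) ▷ μ.app Y =
      eqToHom (μ.naturality f) ≫ (μ.app X ◁ functor.map₂ θ) ≫ eqToHom (μ.naturality g).symm
  assoc : ∀ X : K, functor.toFunctor.map (μ.app X) ≫ μ.app X =
    μ.app (functor.toFunctor.obj X) ≫ μ.app X
  left_unit : ∀ X : K, η.app (functor.toFunctor.obj X) ≫ μ.app X =
    𝟙 (functor.toFunctor.obj X)
  right_unit : ∀ X : K, functor.toFunctor.map (η.app X) ≫ μ.app X =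
    𝟙 (functor.toFunctor.obj X)

namespace TwoMonad

variable {K : Type u} [Bicategory.{w, w} K] [Bicategory.Strict K] (T : TwoMonad K)

/-- The underlying ordinary monad of a 2-monad. -/
def toMonad : Monad K where
  toFunctor := T.functor.toFunctor
  η := T.η
  μ := T.μ
  assoc := T.assoc
  left_unit := T.left_unit
  right_unit := T.right_unit

/-- The action of a 2-monad on 2-cells. -/
def map₂ {X Y : K} {f g : X ⟶ Y} (θ : f ⟶ g) : T.toMonad.map f ⟶ T.toMonad.map g :=
  T.functor.map₂ θ

/-- `T` has rank: it preserves `κ`-filtered colimits for some regular cardinal `κ`. -/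
def HasRank : Prop := T.toMonad.toFunctor.IsAccessible.{w}

/-- The underlying ordinary category of the 2-category `T-Alg_s`: strict `T`-algebras and strict
`T`-morphisms. -/
abbrev AlgS := T.toMonad.Algebra

/-- The free `T`-algebra on an object. -/
abbrev freeAlg (X : K) : T.AlgS := T.toMonad.free.obj X

variable {T}

/-! ### Pseudomorphisms and `T`-transformations -/

lemma pseudo_unit_aux {A B : T.AlgS} (f : A.A ⟶ B.A) :
    T.toMonad.η.app A.A ≫ T.toMonad.map f ≫ B.a = T.toMonad.η.app A.A ≫ A.a ≫ f := by
  have h₁ : T.toMonad.η.app A.A ≫ T.toMonad.map f ≫ B.a = f ≫ T.toMonad.η.app B.A ≫ B.a :=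
    (Monad.unit_naturality_assoc K T.toMonad f B.a).symm
  have h₂ : T.toMonad.η.app A.A ≫ A.a ≫ f = (T.toMonad.η.app A.A ≫ A.a) ≫ f :=
    (Category.assoc _ _ _).symm
  exact h₁.trans ((congrArg (f ≫ ·) B.unit).trans ((Category.comp_id f).trans
    ((Category.id_comp f).symm.trans ((congrArg (· ≫ f) A.unit).symm.trans h₂.symm))))

lemma pseudo_mul_aux₁ {A B : T.AlgS} (f : A.A ⟶ B.A) :
    T.toMonad.μ.app A.A ≫ T.toMonad.map f ≫ B.a =
      T.toMonad.map (T.toMonad.map f ≫ B.a) ≫ B.a := by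
  rw [Functor.map_comp, Category.assoc, ← B.assoc, Monad.mu_naturality_assoc]

lemma pseudo_mul_aux₂ {A B : T.AlgS} (f : A.A ⟶ B.A) :
    T.toMonad.map (A.a ≫ f) ≫ B.a = T.toMonad.map A.a ≫ T.toMonad.map f ≫ B.a := by
  rw [Functor.map_comp, Category.assoc]

lemma pseudo_mul_aux₃ {A B : T.AlgS} (f : A.A ⟶ B.A) :
    T.toMonad.map A.a ≫ A.a ≫ f = T.toMonad.μ.app A.A ≫ A.a ≫ f := by
  rw [← Category.assoc, ← A.assoc, Category.assoc]

/-- A pseudo `T`-morphism between strict `T`-algebras: a 1-cell `f` of `K` with an invertible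
2-cell `Tf ≫ b ≅ a ≫ f` satisfying the unit and multiplication coherence conditions. -/
structure PseudoHom (A B : T.AlgS) where
  f : A.A ⟶ B.A
  iso : T.toMonad.map f ≫ B.a ≅ A.a ≫ f
  unit : T.toMonad.η.app A.A ◁ iso.hom = eqToHom (pseudo_unit_aux f)
  mul : T.toMonad.μ.app A.A ◁ iso.hom =
    eqToHom (pseudo_mul_aux₁ f) ≫ (T.map₂ iso.hom ▷ B.a) ≫ eqToHom (pseudo_mul_aux₂ f) ≫
      (T.toMonad.map A.a ◁ iso.hom) ≫ eqToHom (pseudo_mul_aux₃ f)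

/-- A `T`-transformation between pseudo `T`-morphisms. -/
@[ext]
structure Transformation {A B : T.AlgS} (f g : PseudoHom A B) where
  cell : f.f ⟶ g.f
  comm : (T.map₂ cell ▷ B.a) ≫ g.iso.hom = f.iso.hom ≫ (A.a ◁ cell)

lemma map₂_id {X Y : K} (f : X ⟶ Y) : T.map₂ (𝟙 f) = 𝟙 (T.toMonad.map f) :=
  T.functor.map₂_id f

lemma map₂_comp {X Y : K} {f g h : X ⟶ Y} (θ : f ⟶ g) (θ' : g ⟶ h) :
    T.map₂ (θ ≫ θ') = T.map₂ θ ≫ T.map₂ θ' :=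
  T.functor.map₂_comp θ θ'

lemma map₂_eqToHom {X Y : K} {f g : X ⟶ Y} (h : f = g) :
    T.map₂ (eqToHom h) = eqToHom (by rw [h]) := by
  subst h
  exact map₂_id _

lemma map₂_whiskerRight {X Y Z : K} {f g : X ⟶ Y} (θ : f ⟶ g) (h : Y ⟶ Z) :
    T.map₂ (θ ▷ h) = eqToHom (T.toMonad.map_comp f h) ≫
      (T.map₂ θ ▷ T.toMonad.map h) ≫ eqToHom (T.toMonad.map_comp g h).symm := by
  have := T.functor.map₂_whisker_right θ h
  simp only [StrictPseudofunctor.mapComp_eq_eqToIso, eqToIso.hom, eqToIso.inv] at this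
  exact this

/-- The hom-categories of `T-Alg`. -/
instance (A B : T.AlgS) : Category (PseudoHom A B) where
  Hom := Transformation
  id f := ⟨𝟙 _, by simp [map₂_id]⟩
  comp {f g h} α β := ⟨α.cell ≫ β.cell, by
    rw [map₂_comp, comp_whiskerRight, Category.assoc, β.comm, ← Category.assoc, α.comm,
      Category.assoc, whiskerLeft_comp]⟩
  id_comp _ := Transformation.ext (Category.id_comp _)
  comp_id _ := Transformation.ext (Category.comp_id _)
  assoc _ _ _ := Transformation.ext (Category.assoc _ _ _)

/-- A strict `T`-morphism regarded as a pseudo `T`-morphism. -/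
def PseudoHom.ofStrict {A B : T.AlgS} (u : A ⟶ B) : PseudoHom A B where
  f := u.f
  iso := eqToIso u.h
  unit := by simp
  mul := by simp [map₂_eqToHom]

lemma strict_whiskerRight_comp {W X Y Z : K} {f g : W ⟶ X} (θ : f ⟶ g) (h : X ⟶ Y) (k : Y ⟶ Z) :
    θ ▷ h ▷ k = eqToHom (Category.assoc f h k) ≫ (θ ▷ (h ≫ k)) ≫
      eqToHom (Category.assoc g h k).symm := by
  simp [Bicategory.Strict.associator_eqToIso]

lemma strict_whisker_assoc {W X Y Z : K} (h : W ⟶ X) {f g : X ⟶ Y} (θ : f ⟶ g) (k : Y ⟶ Z) :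
    h ◁ (θ ▷ k) = eqToHom (Category.assoc h f k).symm ≫ ((h ◁ θ) ▷ k) ≫
      eqToHom (Category.assoc h g k) := by
  simp [Bicategory.Strict.associator_eqToIso]

lemma whiskerRight_congr {X Y Z : K} {f g : X ⟶ Y} (θ : f ⟶ g) {h k : Y ⟶ Z} (e : h = k) :
    θ ▷ h = eqToHom (by rw [e]) ≫ (θ ▷ k) ≫ eqToHom (by rw [e]) := by
  subst e
  simp

/-- The composite of a pseudo `T`-morphism with a strict one. -/
def PseudoHom.compStrict {A B C : T.AlgS} (p : PseudoHom A B) (u : B ⟶ C) : PseudoHom A C where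
  f := p.f ≫ u.f
  iso := eqToIso (by rw [Functor.map_comp, Category.assoc, u.h, Category.assoc]) ≪≫
    whiskerRightIso p.iso u.f ≪≫ eqToIso (Category.assoc _ _ _)
  unit := by
    simp [strict_whisker_assoc, p.unit]
  mul := by
    simp only [Iso.trans_hom, eqToIso.hom, whiskerRightIso_hom, map₂_comp, map₂_eqToHom,
      map₂_whiskerRight, Bicategory.comp_whiskerRight, Bicategory.whiskerLeft_comp,
      strict_whisker_assoc, p.mul]
    simp only [strict_whiskerRight_comp, whiskerRight_congr (T.map₂ p.iso.hom) u.h,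
      eqToHom_whiskerRight, whiskerLeft_eqToHom, eqToHom_trans, eqToHom_trans_assoc,
      Category.assoc]

lemma map₂_whiskerLeft {X Y Z : K} (h : X ⟶ Y) {f g : Y ⟶ Z} (θ : f ⟶ g) :
    T.map₂ (h ◁ θ) = eqToHom (T.toMonad.map_comp h f) ≫
      (T.toMonad.map h ◁ T.map₂ θ) ≫ eqToHom (T.toMonad.map_comp h g).symm := by
  have := T.functor.map₂_whisker_left h θ
  simp only [StrictPseudofunctor.mapComp_eq_eqToIso, eqToIso.hom, eqToIso.inv] at this
  exact this

lemma strict_comp_whiskerLeft {W X Y Z : K} (h : W ⟶ X) (k : X ⟶ Y) {f g : Y ⟶ Z} (θ : f ⟶ g) :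
    h ◁ (k ◁ θ) = eqToHom (Category.assoc h k f).symm ≫ ((h ≫ k) ◁ θ) ≫
      eqToHom (Category.assoc h k g) := by
  simp [Bicategory.Strict.associator_eqToIso]

/-- The hom-categories of the 2-category `T-Alg_s`: objects are strict `T`-morphisms and morphisms
are `T`-transformations. -/
abbrev StrictHom (A B : T.AlgS) : Type w :=
  InducedCategory (PseudoHom A B) (PseudoHom.ofStrict : (A ⟶ B) → PseudoHom A B)

lemma precomp_aux {A A' B : T.AlgS} (p : PseudoHom A A') {u v : A' ⟶ B} (θ : u.f ⟶ v.f)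
    (h : (T.map₂ θ ▷ B.a) = eqToHom u.h ≫ (A'.a ◁ θ) ≫ eqToHom v.h.symm) :
    (T.map₂ (p.f ◁ θ) ▷ B.a) ≫ (p.compStrict v).iso.hom =
      (p.compStrict u).iso.hom ≫ (A.a ◁ (p.f ◁ θ)) := by
  have e : (T.toMonad.map p.f ◁ T.map₂ θ) ▷ B.a =
      eqToHom (Category.assoc _ _ _) ≫ (T.toMonad.map p.f ◁ (T.map₂ θ ▷ B.a)) ≫
        eqToHom (Category.assoc _ _ _).symm := by
    simp only [strict_whisker_assoc, eqToHom_trans, eqToHom_trans_assoc, Category.assoc,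
      eqToHom_refl, Category.id_comp, Category.comp_id]
  simp only [PseudoHom.compStrict, Iso.trans_hom, eqToIso.hom, whiskerRightIso_hom,
    map₂_whiskerLeft, Bicategory.comp_whiskerRight, eqToHom_whiskerRight,
    Category.assoc, e, h, Bicategory.whiskerLeft_comp, whiskerLeft_eqToHom,
    strict_comp_whiskerLeft, eqToHom_trans, eqToHom_trans_assoc]
  simp only [eqToHom_refl, Category.id_comp]
  rw [whisker_exchange_assoc]

/-- Precomposition with a pseudo `T`-morphism `p : A ⇝ A'`, as a functor
`T-Alg_s(A', B) ⥤ T-Alg(A, B)`. -/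
def PseudoHom.precomp {A A' : T.AlgS} (p : PseudoHom A A') (B : T.AlgS) :
    StrictHom A' B ⥤ PseudoHom A B where
  obj (u : A' ⟶ B) := p.compStrict u
  map {u v} α := ⟨p.f ◁ α.hom.cell, precomp_aux p (u := u) (v := v) α.hom.cell (by
    have h := α.hom.comm
    simp only [PseudoHom.ofStrict, eqToIso.hom] at h
    rw [comp_eqToHom_iff, Category.assoc] at h
    exact h)⟩
  map_id _ := Transformation.ext (whiskerLeft_id _ _)
  map_comp _ _ := Transformation.ext (whiskerLeft_comp _ _ _)

/-- A value at `A` of the left 2-adjoint of the inclusion `J : T-Alg_s ⥤ T-Alg`: a strict algebra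
`A' = obj` with a universal pseudo `T`-morphism `unit : A ⇝ A'`, that is, such that precomposition
with `unit` is an isomorphism of categories `T-Alg_s(A', B) ≅ T-Alg(A, J B)` for every `B`. -/
structure PseudoClassifier (A : T.AlgS) where
  obj : T.AlgS
  unit : PseudoHom A obj
  isIso : ∀ B : T.AlgS, IsIsoOfCategories (unit.precomp B)

/-- The counit `q : A' ⟶ A`: the unique strict `T`-morphism whose composite with the unit is the
identity. -/
noncomputable def PseudoClassifier.counit {A : T.AlgS} (C : PseudoClassifier A) : C.obj ⟶ A :=
  ((C.isIso A).2.2.surjective (PseudoHom.ofStrict (𝟙 A))).choose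

lemma PseudoClassifier.unit_counit {A : T.AlgS} (C : PseudoClassifier A) :
    C.unit.compStrict C.counit = PseudoHom.ofStrict (𝟙 A) :=
  ((C.isIso A).2.2.surjective (PseudoHom.ofStrict (𝟙 A))).choose_spec

/-- An algebra `A` is flexible if `q : A' ⟶ A` has a section in `T-Alg_s`. (As `A'` is determined
up to an isomorphism compatible with `q`, the choice of `A'` does not matter.) -/
def IsFlexible (A : T.AlgS) : Prop :=
  ∃ (C : PseudoClassifier A) (r : A ⟶ C.obj), r ≫ C.counit = 𝟙 A

end TwoMonad

/-! ## The lifted model structure -/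

section TrivialModelStructure

variable (K : Type u) [Bicategory.{w, w} K] [Bicategory.Strict K]

/-- The equivalences in a 2-category: the weak equivalences of the trivial model structure. -/
def twoCatEquivalences : MorphismProperty K := fun A B f =>
  ∃ g : B ⟶ A, Nonempty (f ≫ g ≅ 𝟙 A) ∧ Nonempty (g ≫ f ≅ 𝟙 B)

/-- The isofibrations in a 2-category: the fibrations of the trivial model structure. -/
def twoCatIsofibrations : MorphismProperty K := fun A B f =>
  ∀ (X : K) (a : X ⟶ A) (b : X ⟶ B) (β : b ≅ a ≫ f),
    ∃ (a' : X ⟶ A) (α : a' ≅ a) (h : a' ≫ f = b), α.hom ▷ f = eqToHom h ≫ β.hom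

end TrivialModelStructure

namespace TwoMonad

variable {K : Type u} [Bicategory.{w, w} K] [Bicategory.Strict K] (T : TwoMonad K)

/-- A strict `T`-morphism is a weak equivalence if it is an equivalence in `K`. -/
instance : CategoryWithWeakEquivalences T.AlgS where
  weakEquivalences := (twoCatEquivalences K).inverseImage T.toMonad.forget

/-- A strict `T`-morphism is a fibration if it is an isofibration in `K`. -/
instance : CategoryWithFibrations T.AlgS where
  fibrations := (twoCatIsofibrations K).inverseImage T.toMonad.forget

/-- A strict `T`-morphism is a cofibration if it has the left lifting property with respect to the
trivial fibrations. -/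
instance : CategoryWithCofibrations T.AlgS where
  cofibrations := (trivialFibrations T.AlgS).llp

/-- The free algebra on an initial object is initial. -/
instance [HasInitial K] : HasInitial T.AlgS :=
  have : PreservesColimitsOfSize.{0, 0} T.toMonad.free := T.toMonad.adj.leftAdjoint_preservesColimits
  (IsInitial.isInitialObj T.toMonad.free (⊥_ K) initialIsInitial).hasInitial

end TwoMonad

/-!
Write `q : A' ⟶ A` for the counit and `p : A ⇝ A'` for the universal pseudo `T`-morphism.

*Trivial fibrations.* An isofibration `f : E ⟶ B` of `K` that is an equivalence has a strict
section, and whiskering with it is fully faithful. Hence every pseudo `T`-morphism `A ⇝ B` lifts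
along a strict trivial fibration `E ⟶ B` to a pseudo `T`-morphism `A ⇝ E`: a section lifts the
1-cell, and full faithfulness lifts the structure 2-cell and its laws (`exists_pseudoHom_lift`).
Translated by the universal property of `A'`, this says that `A'` is cofibrant.

*The counit is a trivial fibration.* One has `p ≫ q = 𝟙` strictly, and an equivalence with a
strict section is an isofibration, so an isomorphism `q ≫ p ≅ 𝟙` suffices. It comes from the
pseudolimit `L` of the 1-cell `p`, which carries a universal invertible 2-cell `u ≫ p ≅ v`. This
object lifts to a strict algebra with strict projections `u` and `v`, universal among pseudo
`T`-morphisms (`exists_commaAlgebra`, `exists_pseudoHom_commaAlgebra`). The pseudo `T`-morphism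
`A ⇝ L` induced by the identity 2-cell of `p` corresponds to a strict morphism `d : A' ⟶ L` with
`d ≫ u = q` and `d ≫ v = 𝟙`, and whiskering the universal 2-cell with `d` gives the isomorphism.

*The theorem.* If `A` is cofibrant, lifting `𝟙 A` along the trivial fibration `q` gives a
section, so `A` is flexible. If `A` is flexible, it is a retract of the cofibrant algebra `A'`.
A free algebra is cofibrant since a morphism out of it can be lifted along the section of a
trivial fibration in `K`.

*Existence of `A'`.* A pseudo `T`-morphism out of `A` consists of a 1-cell out of `A`, two
mutually inverse 2-cells between 1-cells out of `T A`, and equations. Representing 2-cells by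
tensors with the arrow category, an algebra with the one-dimensional universal property of `A'`
is thus obtained from a free algebra by forming coequalizers (`exists_universal_pseudoHom`). The
two-dimensional part of the universal property follows by applying the one-dimensional part to
cotensors with the arrow category (`exists_pseudoClassifier`).

*Coequalizers of algebras.* These exist because the category of algebras over an accessible
monad on a locally presentable category is cocomplete (`Monad.hasColimitsOfSize_algebra`). Let
`S` be a small dense subcategory of presentable objects. Algebras embed, by the nerve, in the
presheaves on the category of free algebras on objects of `S`, and a presheaf is a nerve exactly
if its restriction to `S` is representable by an object of the base category. This is
orthogonality to a small set of morphisms between presentable objects, and such an orthogonality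
class is reflective.

Equations between 2-cells are handled in terms of the type `Cell X Y` of 2-cells bundled with
their source and target, for which associativity of whiskering in a strict bicategory is a plain
equality.
-/

/-! ### Orthogonality and restricted Yoneda functors -/

namespace CategoryTheory

open Opposite

/-- The reflection of `Q` is `Q` itself as soon as `Q` is orthogonal to the reflection maps of the
objects of a `κ`-filtered generator. -/
lemma Adjunction.isIso_unit_app_of_generator {A M : Type*} [Category* A] [Category* M]
    {L : M ⥤ A} {R : A ⥤ M} (adj : L ⊣ R) [R.Full] [R.Faithful] (κ : Cardinal.{w})
    [Fact κ.IsRegular] [R.IsCardinalAccessible κ] {P : ObjectProperty M}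
    (hP : P.IsCardinalFilteredGenerator κ) (Q : M)
    (hQ : ∀ X, P X → Function.Bijective
      (fun g : R.obj (L.obj X) ⟶ Q => adj.unit.app X ≫ g)) :
    IsIso (adj.unit.app Q) := by
  obtain ⟨J, _, _, ⟨p⟩⟩ := hP.exists_colimitsOfShape Q
  have inj : ∀ {X : M} {Y : A} (f g : R.obj (L.obj X) ⟶ R.obj Y),
      adj.unit.app X ≫ f = adj.unit.app X ≫ g → f = g := by
    intro X Y f g h
    obtain ⟨f, rfl⟩ := R.map_surjective f
    obtain ⟨g, rfl⟩ := R.map_surjective g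
    exact congrArg R.map ((adj.homEquiv X Y).injective
      (by simpa [Adjunction.homEquiv_unit] using h))
  -- write `Q` as a colimit of generators: their extensions along the unit assemble to a retraction
  choose e he using fun j => (hQ _ (p.prop_diag_obj j)).2 (p.ι.app j)
  have := adj.isLeftAdjoint
  have := R.preservesColimitsOfShape_of_isCardinalAccessible κ J
  let hc := isColimitOfPreserves (L ⋙ R) p.isColimit
  let c : Cocone (p.diag ⋙ L ⋙ R) :=
    { pt := Q
      ι :=
        { app := e
          naturality := fun i j f => by
            apply (hQ _ (p.prop_diag_obj i)).1
            have h1 := adj.unit.naturality (p.diag.map f)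
            dsimp at h1 he ⊢
            rw [← reassoc_of% h1, he, Category.comp_id, he]
            simp } }
  let r : R.obj (L.obj Q) ⟶ Q := hc.desc c
  have hr : ∀ j, R.map (L.map (p.ι.app j)) ≫ r = e j := fun j => hc.fac c j
  have h1 : adj.unit.app Q ≫ r = 𝟙 Q := by
    apply p.isColimit.hom_ext
    intro j
    have h1 := adj.unit.naturality (p.ι.app j)
    dsimp at h1 he ⊢
    rw [reassoc_of% h1, hr, he, Category.comp_id]
  exact ⟨r, h1, inj _ _ (by rw [reassoc_of% h1, Category.comp_id])⟩

section

variable {C : Type u} [Category.{w} C] {S : Type w} [SmallCategory S] (ι : S ⥤ C)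

/-- The restricted Yoneda functor of a family of `κ`-presentable objects preserves `κ`-filtered
colimits, since these are computed pointwise in presheaves. -/
lemma isCardinalAccessible_restrictedULiftYoneda (κ : Cardinal.{w}) [Fact κ.IsRegular]
    (h : ∀ s, IsCardinalPresentable (ι.obj s) κ) :
    (Presheaf.restrictedULiftYoneda.{w} ι).IsCardinalAccessible κ where
  preservesColimitOfShape J _ _ := by
    have : ∀ k : Sᵒᵖ, PreservesColimitsOfShape J
        (Presheaf.restrictedULiftYoneda.{w} ι ⋙ (evaluation _ _).obj k) := fun k =>
      have := preservesColimitsOfShape_of_isCardinalPresentable (ι.obj k.unop) κ J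
      inferInstanceAs (PreservesColimitsOfShape J
        (coyoneda.obj (op (ι.obj k.unop)) ⋙ uliftFunctor.{w}))
    exact preservesColimitsOfShape_of_evaluation _ _ this

/-- The presheaf represented by a value of a fully faithful functor is a representable presheaf,
hence it is presentable. -/
lemma isCardinalPresentable_restrictedULiftYoneda_obj [ι.Full] [ι.Faithful]
    (κ : Cardinal.{w}) [Fact κ.IsRegular] (s : S) :
    IsCardinalPresentable ((Presheaf.restrictedULiftYoneda.{w} ι).obj (ι.obj s)) κ := by
  let f : uliftYoneda.{w}.obj s ⟶ (Presheaf.restrictedULiftYoneda.{w} ι).obj (ι.obj s) :=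
    { app k := ↾fun x => ULift.up (ι.map x.down)
      naturality k l f := by
        ext x
        apply ULift.down_injective
        exact ι.map_comp _ _ }
  have : IsIso f := by
    rw [NatTrans.isIso_iff_isIso_app]
    intro k
    rw [isIso_iff_bijective]
    refine ⟨fun x y h => ?_, fun x => ⟨⟨ι.preimage x.down⟩, ?_⟩⟩
    · exact ULift.down_injective (ι.map_injective (congrArg ULift.down h))
    · exact ULift.down_injective (ι.map_preimage _)
  exact isCardinalPresentable_of_iso (asIso f) κ

end

end CategoryTheory

/-! ### The nerve of an algebra -/

namespace CategoryTheory

open Opposite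

namespace Monad

variable {C : Type u} [Category.{w} C] (T : Monad C) {S : Type w} [SmallCategory S] (ι : S ⥤ C)

variable {T} in
/-- The morphism of algebras induced by a generalized element `x` restricts to `x` along the
unit. -/
lemma Algebra.eta_map_a (B : T.Algebra) {X : C} (x : X ⟶ B.A) :
    T.η.app X ≫ T.map x ≫ B.a = x :=
  (Monad.unit_naturality_assoc C T x B.a).symm.trans
    ((congrArg (x ≫ ·) B.unit).trans (Category.comp_id x))

/-- The objects of `S`, seen as free `T`-algebras on their images under `ι`. -/
structure FreeOn (T : Monad C) (ι : S ⥤ C) : Type w where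
  /-- the underlying object of `S` -/
  as : S

variable {T ι} in
/-- Morphisms of free algebras, in Kleisli form. -/
@[ext]
structure FreeOn.Hom (d s : FreeOn T ι) : Type w where
  /-- the restriction to the generators -/
  hom : ι.obj d.as ⟶ T.obj (ι.obj s.as)

/-- The full subcategory of the Kleisli category of `T` on the objects of `S`. -/
instance : SmallCategory (FreeOn T ι) where
  Hom := FreeOn.Hom
  id s := ⟨T.η.app _⟩
  comp f g := ⟨f.hom ≫ T.map g.hom ≫ T.μ.app _⟩
  id_comp f := FreeOn.Hom.ext (by
    rw [← T.unit_naturality_assoc, T.left_unit]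
    exact Category.comp_id _)
  comp_id f := FreeOn.Hom.ext (by
    rw [T.right_unit]
    exact Category.comp_id _)
  assoc f g h := FreeOn.Hom.ext (by
    simp only [Functor.map_comp, Category.assoc, T.assoc, T.mu_naturality_assoc])

variable {T ι} in
@[ext]
lemma FreeOn.hom_ext {d s : FreeOn T ι} {f g : d ⟶ s} (h : f.hom = g.hom) : f = g :=
  FreeOn.Hom.ext h

variable {T ι} in
@[simp]
lemma FreeOn.comp_hom {e d s : FreeOn T ι} (f : e ⟶ d) (g : d ⟶ s) :
    (f ≫ g).hom = f.hom ≫ T.map g.hom ≫ T.μ.app _ := rfl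

variable {T ι} in
@[simp]
lemma FreeOn.id_hom (s : FreeOn T ι) : FreeOn.Hom.hom (𝟙 s) = T.η.app _ := rfl

/-- The restriction to `S` of the functor from `C` to the Kleisli category. -/
@[simps]
def toFreeOn : S ⥤ FreeOn T ι where
  obj s := ⟨s⟩
  map f := ⟨ι.map f ≫ T.η.app _⟩
  map_id s := by ext; simp
  map_comp f g := by
    ext
    simpa using congrArg (ι.map f ≫ ·) (Monad.unit_naturality C T (ι.map g))

/-- The nerve of an algebra: the presheaf of morphisms from free algebras on objects of `S`. -/
@[simps]
def nerve : T.Algebra ⥤ (FreeOn T ι)ᵒᵖ ⥤ Type w where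
  obj B :=
    { obj k := ι.obj k.unop.as ⟶ B.A
      map f := ↾fun x => f.unop.hom ≫ T.map x ≫ B.a
      map_id k := by
        ext x
        simp [← T.unit_naturality_assoc, B.unit]
      map_comp f g := by
        ext x
        have h : T.μ.app _ ≫ T.map x ≫ B.a = T.map (T.map x) ≫ T.map B.a ≫ B.a := by
          rw [← B.assoc, T.mu_naturality_assoc]
        simp [h] }
  map u :=
    { app k := ↾fun x => x ≫ u.f
      naturality k l f := by
        ext x
        simp [u.h] }

/-- The restriction of the nerve of `B` to `S` is the presheaf represented by the object
underlying `B`. -/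
def toFreeOnCompNerve (B : T.Algebra) : (toFreeOn T ι).op ⋙ (nerve T ι).obj B ≅
    (Presheaf.restrictedULiftYoneda.{w} ι).obj B.A :=
  NatIso.ofComponents (fun k => Equiv.toIso Equiv.ulift.symm) (by
    intro k l f
    ext x
    apply ULift.down_injective
    exact (Category.assoc _ _ _).trans (congrArg (ι.map f.unop ≫ ·) (B.eta_map_a x)))

end Monad

/-- Morphisms from `F.obj X` are the compatible families of morphisms from the objects
`F.obj (ι.obj s)` for `s` in `S` over `X`: the functor `F` preserves the canonical colimits of
`ι`. -/
structure Functor.PreservesDense {C D S : Type*} [Category* C] [Category* D] [Category* S]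
    (ι : S ⥤ C) (F : C ⥤ D) : Prop where
  hom_ext : ∀ {X : C} {Y : D} (f g : F.obj X ⟶ Y),
    (∀ (s : S) (x : ι.obj s ⟶ X), F.map x ≫ f = F.map x ≫ g) → f = g
  exists_desc : ∀ {X : C} {Y : D} (h : ∀ (s : S), (ι.obj s ⟶ X) → (F.obj (ι.obj s) ⟶ Y)),
    (∀ {s s' : S} (v : s' ⟶ s) (x : ι.obj s ⟶ X), h s' (ι.map v ≫ x) = F.map (ι.map v) ≫ h s x) →
    ∃ f : F.obj X ⟶ Y, ∀ s x, F.map x ≫ f = h s x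

lemma Functor.PreservesDense.of_preservesColimits {C D S : Type*} [Category* C] [Category* D]
    [Category* S] (ι : S ⥤ C) (F : C ⥤ D) [ι.IsDense]
    (hF : ∀ X, PreservesColimitsOfShape (CostructuredArrow ι X) F) :
    Functor.PreservesDense ι F where
  hom_ext {X Y} f g h := by
    refine (isColimitOfPreserves F (ι.denseAt X)).hom_ext fun j => ?_
    change F.map (𝟙 _ ≫ j.hom) ≫ f = F.map (𝟙 _ ≫ j.hom) ≫ g
    rw [Category.id_comp]
    exact h j.left j.hom
  exists_desc {X Y} h hh := by
    let c : Cocone ((CostructuredArrow.proj ι X ⋙ ι) ⋙ F) :=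
      { pt := Y
        ι :=
          { app j := h j.left j.hom
            naturality i j f := by
              have := hh f.left j.hom
              rw [CostructuredArrow.w] at this
              exact (this.symm.trans (Category.comp_id _).symm) } }
    refine ⟨(isColimitOfPreserves F (ι.denseAt X)).desc c, fun s x => ?_⟩
    have : F.map (𝟙 _ ≫ x) ≫ _ = _ :=
      (isColimitOfPreserves F (ι.denseAt X)).fac c (CostructuredArrow.mk x)
    rwa [Category.id_comp] at this

namespace Monad

variable {C : Type u} [Category.{w} C] {T : Monad C} {S : Type w} [SmallCategory S] {ι : S ⥤ C}

instance nerve_faithful [ι.IsDense] : (nerve T ι).Faithful where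
  map_injective {B B'} u v h := by
    ext
    refine (Functor.PreservesDense.of_preservesColimits ι (𝟭 C)
      (fun _ => inferInstance)).hom_ext _ _ fun s x => ?_
    exact ConcreteCategory.congr_hom (NatTrans.congr_app h (op ⟨s⟩)) x

/-- A morphism between nerves restricts along `S` to a morphism of represented presheaves, hence it
comes from a morphism of `C` by density. That this commutes with the actions can be tested on
elements of `T X` supported on an object of `S`. -/
lemma nerve_full (h₁ : Functor.PreservesDense ι (𝟭 C)) (h₂ : Functor.PreservesDense ι T.toFunctor) :
    (nerve T ι).Full where
  map_surjective {B B'} φ := by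
    have nat : ∀ {d s : FreeOn T ι} (k : d ⟶ s) (x : ι.obj s.as ⟶ B.A),
        φ.app (op d) (k.hom ≫ T.map x ≫ B.a) = k.hom ≫ T.map (φ.app (op s) x) ≫ B'.a :=
      fun k x => ConcreteCategory.congr_hom (φ.naturality k.op) x
    obtain ⟨f, hf⟩ := h₁.exists_desc (X := B.A) (Y := B'.A) (fun s x => φ.app (op ⟨s⟩) x) (by
      intro s s' v x
      refine Eq.trans ?_ ((nat ((toFreeOn T ι).map v) x).trans ?_)
      · exact congrArg _ ((congrArg (ι.map v ≫ ·) (B.eta_map_a x)).symm.trans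
          (Category.assoc _ _ _).symm)
      · exact (Category.assoc _ _ _).trans (congrArg (ι.map v ≫ ·) (B'.eta_map_a _)))
    dsimp at hf
    refine ⟨⟨f, ?_⟩, ?_⟩
    · refine h₂.hom_ext _ _ fun s x => h₁.hom_ext _ _ fun d t => ?_
      dsimp at t ⊢
      rw [← T.map_comp_assoc, hf]
      have := nat (d := ⟨d⟩) (s := ⟨s⟩) ⟨t⟩ x
      rw [← hf] at this
      exact this.symm.trans
        ((Category.assoc _ _ _).trans (congrArg (t ≫ ·) (Category.assoc _ _ _)))
    · ext k x
      exact hf _ x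

/-- A presheaf on `FreeOn T ι` whose restriction to `S` is represented by an object `X` of `C` is
the nerve of an algebra structure on `X`. -/
lemma exists_nerve_iso (h₁ : Functor.PreservesDense ι (𝟭 C))
    (h₂ : Functor.PreservesDense ι T.toFunctor)
    (h₃ : Functor.PreservesDense ι (T.toFunctor ⋙ T.toFunctor))
    (Q : (FreeOn T ι)ᵒᵖ ⥤ Type w) (X : C)
    (φ : (toFreeOn T ι).op ⋙ Q ≅ (Presheaf.restrictedULiftYoneda.{w} ι).obj X) :
    ∃ B : T.Algebra, Nonempty ((nerve T ι).obj B ≅ Q) := by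
  let e (s : S) : Q.obj (op ⟨s⟩) ≃ (ι.obj s ⟶ X) := (φ.app (op s)).toEquiv.trans Equiv.ulift
  have he : ∀ {s s' : S} (v : s' ⟶ s) (q : Q.obj (op ⟨s⟩)),
      e s' (Q.map ((toFreeOn T ι).map v).op q) = ι.map v ≫ e s q := fun v q =>
    congrArg ULift.down (ConcreteCategory.congr_hom (φ.hom.naturality v.op) q)
  -- the action of Kleisli morphisms on the generalized elements of `X`
  let act {d s : S} (t : ι.obj d ⟶ T.obj (ι.obj s)) (x : ι.obj s ⟶ X) : ι.obj d ⟶ X :=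
    e d (Q.map (Quiver.Hom.op (X := (⟨d⟩ : FreeOn T ι)) (Y := ⟨s⟩) ⟨t⟩) ((e s).symm x))
  have act_act : ∀ {c d s : S} (r : ι.obj c ⟶ T.obj (ι.obj d)) (t : ι.obj d ⟶ T.obj (ι.obj s))
      (x : ι.obj s ⟶ X), act r (act t x) = act (r ≫ T.map t ≫ T.μ.app _) x := by
    intro c d s r t x
    simp only [act, Equiv.symm_apply_apply]
    congr 1
    exact (ConcreteCategory.congr_hom (Q.map_comp
      (Quiver.Hom.op (X := (⟨d⟩ : FreeOn T ι)) (Y := ⟨s⟩) ⟨t⟩)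
      (Quiver.Hom.op (X := (⟨c⟩ : FreeOn T ι)) (Y := ⟨d⟩) ⟨r⟩)) _).symm
  have act_map : ∀ {s s' : S} (v : s' ⟶ s) (x : ι.obj s ⟶ X),
      act (ι.map v ≫ T.η.app _) x = ι.map v ≫ x := by
    intro s s' v x
    have := he v ((e s).symm x)
    rwa [Equiv.apply_symm_apply] at this
  have act_comp : ∀ {d s s' : S} (t : ι.obj d ⟶ T.obj (ι.obj s')) (v : s' ⟶ s)
      (x : ι.obj s ⟶ X), act t (ι.map v ≫ x) = act (t ≫ T.map (ι.map v)) x := by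
    intro d s s' t v x
    rw [← act_map, act_act]
    simp [T.right_unit]
  have comp_act : ∀ {c d s : S} (u : c ⟶ d) (t : ι.obj d ⟶ T.obj (ι.obj s))
      (x : ι.obj s ⟶ X), act (ι.map u ≫ t) x = ι.map u ≫ act t x := by
    intro c d s u t x
    rw [← act_map, act_act]
    simp [← T.unit_naturality_assoc]
  -- for each generalized element `x`, the morphism `t ↦ act t x` is induced by density, and these
  -- morphisms assemble to an action of `T` on `X` because `T` preserves the canonical colimits
  have hbar : ∀ (s : S) (x : ι.obj s ⟶ X), ∃ a : T.obj (ι.obj s) ⟶ X,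
      ∀ (d : S) (t : ι.obj d ⟶ T.obj (ι.obj s)), t ≫ a = act t x := fun s x =>
    h₁.exists_desc (fun d t => act t x) (fun u t => comp_act u t x)
  choose bar hbar using hbar
  obtain ⟨a, ha⟩ := h₂.exists_desc (X := X) (Y := X) bar (by
    intro s s' v x
    refine h₁.hom_ext _ _ fun d t => ?_
    dsimp at t ⊢
    rw [hbar, ← Category.assoc, hbar, act_comp])
  have act_eta : ∀ {s : S} (x : ι.obj s ⟶ X), act (T.η.app _) x = x := by
    intro s x
    simpa using act_map (𝟙 s) x
  let B : T.Algebra :=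
    { A := X
      a := a
      unit := by
        refine h₁.hom_ext _ _ fun s x => ?_
        dsimp at x ⊢
        rw [T.unit_naturality_assoc, ha, hbar, act_eta, Category.comp_id]
      assoc := by
        refine h₃.hom_ext _ _ fun s x => ?_
        dsimp at x ⊢
        rw [T.mu_naturality_assoc, ha, ← T.map_comp_assoc, ha]
        refine h₂.hom_ext _ _ fun d t => ?_
        rw [← T.map_comp_assoc, hbar, ha]
        refine h₁.hom_ext _ _ fun c r => ?_
        dsimp at r ⊢
        rw [hbar, act_act, ← hbar]
        simp }
  refine ⟨B, ⟨NatIso.ofComponents (fun k => Equiv.toIso (e k.unop.as).symm) ?_⟩⟩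
  intro k l f
  ext x
  apply (e l.unop.as).injective
  exact (Equiv.apply_symm_apply _ _).trans
    ((congrArg (f.unop.hom ≫ ·) (ha k.unop.as x)).trans (hbar _ _ _ _))

end Monad

end CategoryTheory

/-! ### Cocompleteness of categories of algebras -/

namespace CategoryTheory

open Opposite

/-- A locally presentable category and an accessible endofunctor on it admit a common index of
accessibility. -/
lemma exists_isCardinalLocallyPresentable_isCardinalAccessible {C : Type u} [Category.{w} C]
    [IsLocallyPresentable.{w} C] (F : C ⥤ C) (hF : F.IsAccessible.{w}) :
    ∃ (κ : Cardinal.{w}) (_ : Fact κ.IsRegular), IsCardinalLocallyPresentable C κ ∧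
      F.IsCardinalAccessible κ := by
  obtain ⟨κ₁, _, _⟩ := IsLocallyPresentable.exists_cardinal.{w} C
  obtain ⟨κ₂, _, _⟩ := hF.exists_cardinal
  have : Fact (κ₁ ⊔ κ₂).IsRegular := ⟨iteInduction (fun _ ↦ Fact.out) (fun _ ↦ Fact.out)⟩
  exact ⟨κ₁ ⊔ κ₂, this, IsCardinalLocallyPresentable.of_le C le_sup_left,
    F.isCardinalAccessible_of_le le_sup_right⟩

/-- The canonical diagrams of a small dense model of the `κ`-presentable objects are
`κ`-filtered. -/
lemma exists_dense_small_functor {C : Type u} [Category.{w} C] (κ : Cardinal.{w})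
    [Fact κ.IsRegular] [IsCardinalLocallyPresentable C κ] :
    ∃ (S : Type w) (_ : SmallCategory S) (ι : S ⥤ C), ι.Full ∧ ι.Faithful ∧ ι.IsDense ∧
      (∀ s, IsCardinalPresentable (ι.obj s) κ) ∧
      (∀ X, IsCardinalPresentable X κ → ∃ s, Nonempty (ι.obj s ≅ X)) ∧
      ∀ X, IsCardinalFiltered (CostructuredArrow ι X) κ := by
  let P := isCardinalPresentable C κ
  let E := equivSmallModel.{w} P.FullSubcategory
  refine ⟨SmallModel.{w} P.FullSubcategory, inferInstance, E.inverse ⋙ P.ι, inferInstance,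
    inferInstance, inferInstance, fun s => (E.inverse.obj s).property, fun X hX => ?_, fun X => ?_⟩
  · exact ⟨E.functor.obj ⟨X, hX⟩, ⟨P.ι.mapIso (E.unitIso.symm.app ⟨X, hX⟩)⟩⟩
  · have : IsCardinalFiltered (CostructuredArrow P.ι X) κ :=
      inferInstanceAs (IsCardinalFiltered (CostructuredArrow (isCardinalPresentable C κ).ι X) κ)
    exact IsCardinalFiltered.of_equivalence κ
      (CostructuredArrow.pre E.inverse P.ι X).asEquivalence.symm

/-- Orthogonality of `Q` to the image of a morphism under a left adjoint is orthogonality of the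
image of `Q` under the right adjoint. -/
lemma Adjunction.bijective_map_comp_iff {A B : Type*} [Category* A] [Category* B] {F : A ⥤ B}
    {G : B ⥤ A} (adj : F ⊣ G) {X Y : A} (f : X ⟶ Y) (Q : B) :
    Function.Bijective (fun g : F.obj Y ⟶ Q => F.map f ≫ g) ↔
      Function.Bijective (fun g : Y ⟶ G.obj Q => f ≫ g) := by
  rw [← (adj.homEquiv X Q).bijective.of_comp_iff',
    ← Function.Bijective.of_comp_iff _ (adj.homEquiv Y Q).bijective]
  exact iff_of_eq (congrArg _ (funext fun g => adj.homEquiv_naturality_left _ _))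

/-- Objects isomorphic to values of a fully faithful right adjoint are orthogonal to the unit. -/
lemma Adjunction.bijective_unit_comp {A M : Type*} [Category* A] [Category* M]
    {L : M ⥤ A} {R : A ⥤ M} (adj : L ⊣ R) [R.Full] [R.Faithful] {Q : M} {Y : A}
    (e : Q ≅ R.obj Y) (X : M) :
    Function.Bijective (fun g : R.obj (L.obj X) ⟶ Q => adj.unit.app X ≫ g) := by
  have h : Function.Bijective
      (fun g : R.obj (L.obj X) ⟶ R.obj Y => adj.unit.app X ≫ g) := by
    rw [← Function.Bijective.of_comp_iff _
      (Functor.FullyFaithful.ofFullyFaithful R).homEquiv.bijective]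
    exact (congrArg Function.Bijective (funext fun g => adj.homEquiv_unit _ _ _)).mp
      (adj.homEquiv X Y).bijective
  rw [← (e.homToEquiv (Z := X)).bijective.of_comp_iff',
    ← Function.Bijective.of_comp_iff _ (e.symm.homToEquiv (Z := R.obj (L.obj X))).bijective]
  exact (congrArg Function.Bijective (funext fun g => by simp)).mp h

/-- A locally presentable category is complete, being reflective in a category of presheaves. -/
lemma hasLimitsOfSize_of_isLocallyPresentable (C : Type u) [Category.{w} C]
    [IsLocallyPresentable.{w} C] : HasLimitsOfSize.{w, w} C := by
  obtain ⟨κ, _, _⟩ := IsLocallyPresentable.exists_cardinal.{w} C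
  obtain ⟨S, _, ι, _, _, _, -⟩ := exists_dense_small_functor (C := C) κ
  have : Reflective (Presheaf.restrictedULiftYoneda.{w} ι) :=
    { L := _
      adj := Presheaf.uliftYonedaAdjunction.{w} _ (uliftYoneda.leftKanExtensionUnit ι) }
  exact hasLimits_of_reflective (Presheaf.restrictedULiftYoneda.{w} ι)

/-- The category of algebras over an accessible monad on a locally presentable category is
cocomplete: it is equivalent to the category of those presheaves on a small category of free
algebras that are orthogonal to a small set of morphisms between presentable objects. -/
theorem Monad.hasColimitsOfSize_algebra {C : Type u} [Category.{w} C]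
    [IsLocallyPresentable.{w} C] (T : Monad C) (hT : T.toFunctor.IsAccessible.{w}) :
    HasColimitsOfSize.{w, w} T.Algebra := by
  obtain ⟨κ, _, _, _⟩ := exists_isCardinalLocallyPresentable_isCardinalAccessible T.toFunctor hT
  obtain ⟨S, _, ι, _, _, _, hι, hι', _⟩ := exists_dense_small_functor (C := C) κ
  have hd (F : C ⥤ C) [F.IsCardinalAccessible κ] : Functor.PreservesDense ι F :=
    Functor.PreservesDense.of_preservesColimits ι F fun X =>
      F.preservesColimitsOfShape_of_isCardinalAccessible_of_essentiallySmall κ _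
  have h₁ := hd (𝟭 C)
  have h₂ := hd T.toFunctor
  have h₃ := hd (T.toFunctor ⋙ T.toFunctor)
  let R := Presheaf.restrictedULiftYoneda.{w} ι
  have := isCardinalAccessible_restrictedULiftYoneda ι κ hι
  obtain ⟨L, ⟨adj⟩⟩ : ∃ L, Nonempty (L ⊣ R) :=
    ⟨_, ⟨Presheaf.uliftYonedaAdjunction.{w} _ (uliftYoneda.leftKanExtensionUnit ι)⟩⟩
  obtain ⟨lan, ⟨adj'⟩⟩ :
      ∃ lan, Nonempty (lan ⊣ (Functor.whiskeringLeft _ _ (Type w)).obj (toFreeOn T ι).op) :=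
    ⟨_, ⟨(toFreeOn T ι).op.lanAdjunction _⟩⟩
  have : IsCardinalLocallyPresentable (Sᵒᵖ ⥤ Type w) κ := inferInstance
  obtain ⟨P, _, hP⟩ := HasCardinalFilteredGenerator.exists_small_generator (Sᵒᵖ ⥤ Type w) κ
  -- A presheaf `Q` should be `W`-local if and only if its restriction to `S` is representable, that
  -- is, orthogonal to the reflection maps; by adjunction it suffices to extend these from `S` to
  -- `FreeOn T ι`, and those of a small generator suffice.
  let W : MorphismProperty ((FreeOn T ι)ᵒᵖ ⥤ Type w) :=
    .ofHoms (fun p : Subtype P => lan.map (adj.unit.app p.1))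
  have hW : ∀ ⦃X Y : (FreeOn T ι)ᵒᵖ ⥤ Type w⦄ (f : X ⟶ Y), W f →
      IsCardinalPresentable X κ ∧ IsCardinalPresentable Y κ := by
    rintro _ _ _ ⟨⟨p, hp⟩⟩
    have : IsCardinalPresentable p κ := hP.le_isCardinalPresentable _ hp
    have : IsCardinalPresentable (R.obj (L.obj p)) κ := by
      have := adj.isCardinalPresentable_leftAdjoint_obj κ p
      obtain ⟨s, ⟨i⟩⟩ := hι' _ this
      have := isCardinalPresentable_restrictedULiftYoneda_obj ι κ s
      exact isCardinalPresentable_of_iso (R.mapIso i) κ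
    exact ⟨adj'.isCardinalPresentable_leftAdjoint_obj κ p,
      adj'.isCardinalPresentable_leftAdjoint_obj κ (R.obj (L.obj p))⟩
  have := W.isRightAdjoint_ι_isLocal κ hW
  have hloc : ∀ Q, W.isLocal Q ↔ ∀ p, P p → Function.Bijective
      (fun g : R.obj (L.obj p) ⟶ (toFreeOn T ι).op ⋙ Q => adj.unit.app p ≫ g) := by
    intro Q
    refine ⟨fun h p hp => (adj'.bijective_map_comp_iff _ Q).1
      (h _ (.mk (⟨p, hp⟩ : Subtype P))), fun h => ?_⟩
    · rintro _ _ _ ⟨⟨p, hp⟩⟩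
      exact (adj'.bijective_map_comp_iff _ Q).2 (h p hp)
  have hN : ∀ B, W.isLocal ((nerve T ι).obj B) :=
    fun B => (hloc _).2 fun p _ => adj.bijective_unit_comp (toFreeOnCompNerve T ι B) p
  let N : T.Algebra ⥤ W.isLocal.FullSubcategory := W.isLocal.lift (nerve T ι) hN
  have : (nerve T ι).Full := nerve_full h₁ h₂
  have : N.EssSurj :=
    { mem_essImage Q := by
        have := adj.isIso_unit_app_of_generator κ hP
          ((toFreeOn T ι).op ⋙ Q.obj) ((hloc _).1 Q.property)
        obtain ⟨B, ⟨i⟩⟩ := exists_nerve_iso h₁ h₂ h₃ Q.obj _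
          (asIso (adj.unit.app ((toFreeOn T ι).op ⋙ Q.obj)))
        exact ⟨B, ⟨W.isLocal.ι.preimageIso i⟩⟩ }
  have : N.IsEquivalence := {}
  have : HasColimitsOfSize.{w, w} W.isLocal.FullSubcategory :=
    have : Reflective W.isLocal.ι := { L := _, adj := Adjunction.ofIsRightAdjoint _ }
    hasColimits_of_reflective W.isLocal.ι
  exact Adjunction.has_colimits_of_equivalence N

end CategoryTheory

/-! ### Bundled 2-cells -/

/-- A 2-cell of a bicategory together with its source and target. Since these are part of the data,
the strict associativity and unit laws of whiskering are plain equalities of such 2-cells. -/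
structure Cell {K : Type u} [Bicategory.{w, w} K] (X Y : K) where
  /-- the source of a 2-cell -/
  src : X ⟶ Y
  /-- the target of a 2-cell -/
  tgt : X ⟶ Y
  /-- the underlying 2-cell -/
  hom : src ⟶ tgt

namespace Cell

variable {K : Type u} [Bicategory.{w, w} K]

/-- A 2-cell, bundled with its source and target. -/
abbrev of {X Y : K} {f g : X ⟶ Y} (α : f ⟶ g) : Cell X Y := ⟨f, g, α⟩

@[simp]
lemma of_eqToHom_comp {X Y : K} {f f' g : X ⟶ Y} (h : f = f') (α : f' ⟶ g) :
    of (eqToHom h ≫ α) = of α := by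
  subst h
  simp

@[simp]
lemma of_comp_eqToHom {X Y : K} {f g g' : X ⟶ Y} (α : f ⟶ g) (h : g = g') :
    of (α ≫ eqToHom h) = of α := by
  subst h
  simp

lemma of_conj {X Y : K} {f f' g g' : X ⟶ Y} (h : f = f') (α : f' ⟶ g) (h' : g = g') :
    of (eqToHom h ≫ α ≫ eqToHom h') = of α := by
  simp

lemma of_injective {X Y : K} {f g : X ⟶ Y} {α β : f ⟶ g} (h : of α = of β) : α = β := by
  cases h
  rfl

/-- A bundled 2-cell whose source and target are known comes from a 2-cell between them. -/
lemma exists_eq_of {X Y : K} (c : Cell X Y) {f g : X ⟶ Y} (hs : c.src = f) (ht : c.tgt = g) :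
    ∃ α : f ⟶ g, c = of α := by
  subst hs ht
  exact ⟨c.hom, rfl⟩

/-- Whiskering on the left. -/
def pre {W X Y : K} (h : W ⟶ X) (c : Cell X Y) : Cell W Y := of (h ◁ c.hom)

/-- Whiskering on the right. -/
def post {X Y Z : K} (c : Cell X Y) (k : Y ⟶ Z) : Cell X Z := of (c.hom ▷ k)

/-- The identity 2-cell of a 1-cell. -/
def idc {X Y : K} (f : X ⟶ Y) : Cell X Y := of (𝟙 f)

open Classical in
/-- Vertical composition; composites of non-composable 2-cells have an irrelevant value, chosen
so that `vcomp_src` and `vcomp_idc` hold unconditionally. -/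
noncomputable def vcomp {X Y : K} (c d : Cell X Y) : Cell X Y :=
  if h : c.tgt = d.src then of (c.hom ≫ eqToHom h ≫ d.hom) else c

/-- Invertible 2-cells. -/
def Invertible {X Y : K} (c : Cell X Y) : Prop := IsIso c.hom

section

variable {W X Y Z : K}

@[simp] lemma pre_src (h : W ⟶ X) (c : Cell X Y) : (pre h c).src = h ≫ c.src := rfl
@[simp] lemma pre_tgt (h : W ⟶ X) (c : Cell X Y) : (pre h c).tgt = h ≫ c.tgt := rfl
@[simp] lemma post_src (c : Cell X Y) (k : Y ⟶ Z) : (post c k).src = c.src ≫ k := rfl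
@[simp] lemma post_tgt (c : Cell X Y) (k : Y ⟶ Z) : (post c k).tgt = c.tgt ≫ k := rfl
@[simp] lemma idc_src (f : X ⟶ Y) : (idc f).src = f := rfl
@[simp] lemma idc_tgt (f : X ⟶ Y) : (idc f).tgt = f := rfl

@[simp] lemma pre_idc (h : W ⟶ X) (f : X ⟶ Y) : pre h (idc f) = idc (h ≫ f) := by
  simp [pre, idc]

@[simp] lemma post_idc (f : X ⟶ Y) (k : Y ⟶ Z) : post (idc f) k = idc (f ≫ k) := by
  simp [post, idc]

lemma of_eqToHom {f g : X ⟶ Y} (h : f = g) : of (eqToHom h) = idc f := by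
  subst h
  rfl

lemma of_comp_eqToHom_comp {f g g' h : X ⟶ Y} (α : f ⟶ g) (e : g = g') (β : g' ⟶ h) :
    of (α ≫ eqToHom e ≫ β) = vcomp (of α) (of β) := by
  subst e
  simp [vcomp]

lemma vcomp_of {f g h : X ⟶ Y} (α : f ⟶ g) (β : g ⟶ h) : vcomp (of α) (of β) = of (α ≫ β) := by
  simp [vcomp]

@[simp] lemma vcomp_src (c d : Cell X Y) : (vcomp c d).src = c.src := by
  unfold vcomp
  split_ifs <;> rfl

lemma vcomp_tgt {c d : Cell X Y} (h : c.tgt = d.src) : (vcomp c d).tgt = d.tgt := by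
  simp [vcomp, h]

@[simp] lemma vcomp_idc (c : Cell X Y) (f : X ⟶ Y) : vcomp c (idc f) = c := by
  unfold vcomp
  split_ifs with h
  · obtain ⟨s, t, α⟩ := c
    obtain rfl : t = f := h
    simp [idc]
  · rfl

lemma idc_vcomp {f : X ⟶ Y} {c : Cell X Y} (h : f = c.src) : vcomp (idc f) c = c := by
  subst h
  exact (vcomp_of _ _).trans (by rw [Category.id_comp])

lemma vcomp_assoc {c d e : Cell X Y} (h : c.tgt = d.src) (h' : d.tgt = e.src) :
    vcomp (vcomp c d) e = vcomp c (vcomp d e) := by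
  obtain ⟨s, t, α⟩ := c
  obtain ⟨s', t', β⟩ := d
  obtain ⟨s'', t'', γ⟩ := e
  obtain rfl : t = s' := h
  obtain rfl : t' = s'' := h'
  rw [vcomp_of, vcomp_of, vcomp_of, vcomp_of, Category.assoc]

lemma pre_vcomp (k : W ⟶ X) {c d : Cell X Y} (h : c.tgt = d.src) :
    pre k (vcomp c d) = vcomp (pre k c) (pre k d) := by
  obtain ⟨s, t, α⟩ := c
  obtain ⟨s', t', β⟩ := d
  obtain rfl : t = s' := h
  rw [vcomp_of, pre, pre, pre, vcomp_of, Bicategory.whiskerLeft_comp]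

lemma post_vcomp {c d : Cell X Y} (h : c.tgt = d.src) (k : Y ⟶ Z) :
    post (vcomp c d) k = vcomp (post c k) (post d k) := by
  obtain ⟨s, t, α⟩ := c
  obtain ⟨s', t', β⟩ := d
  obtain rfl : t = s' := h
  rw [vcomp_of, post, post, post, vcomp_of, Bicategory.comp_whiskerRight]

lemma Invertible.pre {c : Cell X Y} (hc : c.Invertible) (h : W ⟶ X) : (pre h c).Invertible := by
  have : IsIso c.hom := hc
  exact inferInstanceAs (IsIso (h ◁ c.hom))

lemma Invertible.post {c : Cell X Y} (hc : c.Invertible) (k : Y ⟶ Z) : (post c k).Invertible := by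
  have : IsIso c.hom := hc
  exact inferInstanceAs (IsIso (c.hom ▷ k))

lemma Invertible.vcomp {c d : Cell X Y} (hc : c.Invertible) (hd : d.Invertible) :
    (vcomp c d).Invertible := by
  unfold Cell.vcomp
  split_ifs with h
  · have : IsIso c.hom := hc
    have : IsIso d.hom := hd
    exact inferInstanceAs (IsIso (c.hom ≫ eqToHom h ≫ d.hom))
  · exact hc

lemma invertible_idc (f : X ⟶ Y) : (idc f).Invertible := inferInstanceAs (IsIso (𝟙 f))

lemma invertible_iff {c : Cell X Y} : c.Invertible ↔ ∃ d : Cell X Y, d.src = c.tgt ∧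
    d.tgt = c.src ∧ vcomp c d = idc c.src ∧ vcomp d c = idc c.tgt := by
  constructor
  · intro (h : IsIso c.hom)
    refine ⟨of (inv c.hom), rfl, rfl, ?_, ?_⟩
    · exact (vcomp_of _ _).trans (by rw [IsIso.hom_inv_id]; rfl)
    · exact (vcomp_of _ _).trans (by rw [IsIso.inv_hom_id]; rfl)
  · rintro ⟨⟨s', t', β⟩, hs, ht, h₁, h₂⟩
    obtain ⟨s, t, α⟩ := c
    obtain rfl : s' = t := hs
    obtain rfl : t' = s := ht
    rw [vcomp_of] at h₁ h₂
    exact ⟨β, of_injective h₁, of_injective h₂⟩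

end

section

variable [Bicategory.Strict K] {V W X Y Z : K}

@[simp] lemma pre_pre (h : V ⟶ W) (k : W ⟶ X) (c : Cell X Y) :
    pre h (pre k c) = pre (h ≫ k) c := by
  unfold pre
  rw [TwoMonad.strict_comp_whiskerLeft]
  exact of_conj _ _ _

@[simp] lemma post_post (c : Cell W X) (h : X ⟶ Y) (k : Y ⟶ Z) :
    post (post c h) k = post c (h ≫ k) := by
  unfold post
  rw [TwoMonad.strict_whiskerRight_comp]
  exact of_conj _ _ _

@[simp] lemma pre_post (h : W ⟶ X) (c : Cell X Y) (k : Y ⟶ Z) :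
    pre h (post c k) = post (pre h c) k := by
  unfold pre post
  rw [TwoMonad.strict_whisker_assoc]
  exact of_conj _ _ _

@[simp] lemma pre_id (c : Cell X Y) : pre (𝟙 X) c = c := by
  simp [pre, Bicategory.Strict.leftUnitor_eqToIso]

@[simp] lemma post_id (c : Cell X Y) : post c (𝟙 Y) = c := by
  simp [post, Bicategory.Strict.rightUnitor_eqToIso]

end

end Cell

namespace TwoMonad

open Cell

variable {K : Type u} [Bicategory.{w, w} K] [Bicategory.Strict K] (T : TwoMonad K)

/-- The action of a 2-monad on bundled 2-cells. -/
def cell {X Y : K} (c : Cell X Y) : Cell (T.toMonad.obj X) (T.toMonad.obj Y) := of (T.map₂ c.hom)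

section

variable {T} {W X Y Z : K}

@[simp] lemma cell_src (c : Cell X Y) : (T.cell c).src = T.toMonad.map c.src := rfl
@[simp] lemma cell_tgt (c : Cell X Y) : (T.cell c).tgt = T.toMonad.map c.tgt := rfl

@[simp] lemma cell_idc (f : X ⟶ Y) : T.cell (idc f) = idc (T.toMonad.map f) := by
  simp [cell, idc, map₂_id]

lemma cell_vcomp {c d : Cell X Y} (h : c.tgt = d.src) :
    T.cell (vcomp c d) = vcomp (T.cell c) (T.cell d) := by
  obtain ⟨s, t, α⟩ := c
  obtain ⟨s', t', β⟩ := d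
  obtain rfl : t = s' := h
  rw [vcomp_of, cell, cell, cell, vcomp_of, map₂_comp]

@[simp] lemma cell_pre (h : W ⟶ X) (c : Cell X Y) :
    T.cell (pre h c) = pre (T.toMonad.map h) (T.cell c) := by
  simp [cell, pre, map₂_whiskerLeft]

@[simp] lemma cell_post (c : Cell X Y) (k : Y ⟶ Z) :
    T.cell (post c k) = post (T.cell c) (T.toMonad.map k) := by
  simp [cell, post, map₂_whiskerRight]

lemma _root_.Cell.Invertible.cell {c : Cell X Y} (hc : c.Invertible) : (T.cell c).Invertible := by
  have : IsIso c.hom := hc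
  refine ⟨T.map₂ (inv c.hom), ?_, ?_⟩
  · exact (map₂_comp _ _).symm.trans (by rw [IsIso.hom_inv_id, map₂_id]; rfl)
  · exact (map₂_comp _ _).symm.trans (by rw [IsIso.inv_hom_id, map₂_id]; rfl)

@[simp] lemma pre_η_cell (c : Cell X Y) :
    pre (T.toMonad.η.app X) (T.cell c) = post c (T.toMonad.η.app Y) := by
  have h := T.η_two c.hom
  have : post c (T.toMonad.η.app Y) = of (c.hom ▷ T.η.app Y) := rfl
  rw [this, h]
  exact (of_conj _ _ _).symm

@[simp] lemma pre_μ_cell (c : Cell X Y) :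
    pre (T.toMonad.μ.app X) (T.cell c) = post (T.cell (T.cell c)) (T.toMonad.μ.app Y) := by
  have h := T.μ_two c.hom
  have : post (T.cell (T.cell c)) (T.toMonad.μ.app Y) =
    of (T.functor.map₂ (T.functor.map₂ c.hom) ▷ T.μ.app Y) := rfl
  rw [this, h]
  exact (of_conj _ _ _).symm

end

namespace PseudoHom

variable {T} {A B C : T.AlgS}

/-- The structure 2-cell of a pseudo `T`-morphism. -/
def cell (p : PseudoHom A B) : Cell (T.toMonad.obj A.A) B.A := of p.iso.hom

@[simp] lemma cell_src (p : PseudoHom A B) : p.cell.src = T.toMonad.map p.f ≫ B.a := rfl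
@[simp] lemma cell_tgt (p : PseudoHom A B) : p.cell.tgt = A.a ≫ p.f := rfl

lemma invertible_cell (p : PseudoHom A B) : p.cell.Invertible :=
  inferInstanceAs (IsIso p.iso.hom)

@[simp] lemma pre_η_cell (p : PseudoHom A B) :
    pre (T.toMonad.η.app A.A) p.cell = idc p.f := by
  have : pre (T.toMonad.η.app A.A) p.cell = of (T.toMonad.η.app A.A ◁ p.iso.hom) := rfl
  rw [this, p.unit, of_eqToHom]
  congr 1
  exact B.eta_map_a p.f

lemma pre_μ_cell (p : PseudoHom A B) : pre (T.toMonad.μ.app A.A) p.cell =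
    vcomp (post (T.cell p.cell) B.a) (pre (T.toMonad.map A.a) p.cell) := by
  have h : pre (T.toMonad.μ.app A.A) p.cell = of (T.toMonad.μ.app A.A ◁ p.iso.hom) := rfl
  rw [h, p.mul]
  rw [of_eqToHom_comp]
  refine (congrArg of ?_).trans ((of_comp_eqToHom _ (pseudo_mul_aux₃ p.f)).trans
    (of_comp_eqToHom_comp (T.map₂ p.iso.hom ▷ B.a) (pseudo_mul_aux₂ p.f)
      (T.toMonad.map A.a ◁ p.iso.hom)))
  simp only [Category.assoc]

lemma ext_cell {p q : PseudoHom A B} (h : p.f = q.f) (h' : p.cell = q.cell) : p = q := by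
  obtain ⟨f, i, _, _⟩ := p
  obtain ⟨g, j, _, _⟩ := q
  obtain rfl : f = g := h
  obtain rfl : i = j := Iso.ext (of_injective h')
  rfl

/-- Construction of a pseudo `T`-morphism from a 1-cell and a bundled 2-cell. -/
lemma exists_of_cell (f : A.A ⟶ B.A) (c : Cell (T.toMonad.obj A.A) B.A)
    (hs : c.src = T.toMonad.map f ≫ B.a) (ht : c.tgt = A.a ≫ f) (hc : c.Invertible)
    (hη : pre (T.toMonad.η.app A.A) c = idc f)
    (hμ : pre (T.toMonad.μ.app A.A) c =
      vcomp (post (T.cell c) B.a) (pre (T.toMonad.map A.a) c)) :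
    ∃ p : PseudoHom A B, p.f = f ∧ p.cell = c := by
  obtain ⟨s, t, α⟩ := c
  obtain rfl : s = _ := hs
  obtain rfl : t = _ := ht
  have : IsIso α := hc
  refine ⟨⟨f, asIso α, ?_, ?_⟩, rfl, rfl⟩
  · exact of_injective (hη.trans ((congrArg idc (B.eta_map_a f).symm).trans
      (of_eqToHom (pseudo_unit_aux f)).symm))
  · apply of_injective
    rw [of_eqToHom_comp]
    refine hμ.trans ((of_comp_eqToHom_comp (T.map₂ α ▷ B.a) (pseudo_mul_aux₂ f)
      (T.toMonad.map A.a ◁ α)).symm.trans ?_)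
    refine (of_comp_eqToHom _ (pseudo_mul_aux₃ f)).symm.trans (congrArg of ?_)
    simp only [Category.assoc, asIso_hom]

@[simp] lemma compStrict_f (p : PseudoHom A B) (u : B ⟶ C) : (p.compStrict u).f = p.f ≫ u.f := rfl

@[simp] lemma compStrict_cell (p : PseudoHom A B) (u : B ⟶ C) :
    (p.compStrict u).cell = post p.cell u.f := by
  simp [cell, compStrict, post]

@[simp] lemma ofStrict_cell (u : A ⟶ B) : (PseudoHom.ofStrict u).cell = idc (A.a ≫ u.f) :=
  (of_eqToHom u.h).trans (congrArg idc u.h)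

end PseudoHom

lemma exists_transformation {T : TwoMonad K} {A B : T.AlgS} {f g : PseudoHom A B}
    (c : Cell A.A B.A) (hs : c.src = f.f) (ht : c.tgt = g.f)
    (h : vcomp (post (T.cell c) B.a) g.cell = vcomp f.cell (pre A.a c)) :
    ∃ α : f ⟶ g, of (Transformation.cell α) = c := by
  obtain ⟨s, t, α⟩ := c
  obtain rfl : s = _ := hs
  obtain rfl : t = _ := ht
  exact ⟨⟨α, of_injective ((vcomp_of _ _).symm.trans (h.trans (vcomp_of _ _)))⟩, rfl⟩

lemma transformation_comm {T : TwoMonad K} {A B : T.AlgS} {f g : PseudoHom A B} (α : f ⟶ g) :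
    vcomp (post (T.cell (of (Transformation.cell α))) B.a) g.cell =
      vcomp f.cell (pre A.a (of (Transformation.cell α))) :=
  (vcomp_of _ _).trans ((congrArg of α.comm).trans (vcomp_of _ _).symm)

end TwoMonad

/-! ### Comma objects and pseudolimits -/

section

variable {C : Type*} [Category* C] [HasFiniteLimits C]

lemma exists_binary_product (X Y : C) : ∃ (P : C) (p : P ⟶ X) (q : P ⟶ Y),
    (∀ {Z : C} (f : Z ⟶ X) (g : Z ⟶ Y), ∃ h : Z ⟶ P, h ≫ p = f ∧ h ≫ q = g) ∧
    ∀ {Z : C} {h h' : Z ⟶ P}, h ≫ p = h' ≫ p → h ≫ q = h' ≫ q → h = h' :=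
  ⟨X ⨯ Y, prod.fst, prod.snd, fun f g => ⟨prod.lift f g, prod.lift_fst f g, prod.lift_snd f g⟩,
    prod.hom_ext⟩

lemma exists_joint_equalizer {X Y : C} (f f' g g' : X ⟶ Y) : ∃ (E : C) (i : E ⟶ X),
    i ≫ f = i ≫ f' ∧ i ≫ g = i ≫ g' ∧
    (∀ {Z : C} (h : Z ⟶ X), h ≫ f = h ≫ f' → h ≫ g = h ≫ g' → ∃ k : Z ⟶ E, k ≫ i = h) ∧
    ∀ {Z : C} {k k' : Z ⟶ E}, k ≫ i = k' ≫ i → k = k' := by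
  have h := equalizer.condition (prod.lift f g) (prod.lift f' g')
  refine ⟨_, equalizer.ι (prod.lift f g) (prod.lift f' g'), ?_, ?_, fun h h₁ h₂ => ?_,
    fun hk => equalizer.hom_ext hk⟩
  · simpa only [Category.assoc, prod.lift_fst] using h =≫ prod.fst
  · simpa only [Category.assoc, prod.lift_snd] using h =≫ prod.snd
  · exact ⟨equalizer.lift h (by ext <;> simp [h₁, h₂]), equalizer.lift_ι _ _⟩

lemma exists_pullback {X Y Z : C} (f : X ⟶ Z) (g : Y ⟶ Z) : ∃ (P : C) (p : P ⟶ X) (q : P ⟶ Y),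
    p ≫ f = q ≫ g ∧
    (∀ {W : C} (a : W ⟶ X) (b : W ⟶ Y), a ≫ f = b ≫ g → ∃ h : W ⟶ P, h ≫ p = a ∧ h ≫ q = b) ∧
    ∀ {W : C} {h h' : W ⟶ P}, h ≫ p = h' ≫ p → h ≫ q = h' ≫ q → h = h' :=
  ⟨pullback f g, pullback.fst f g, pullback.snd f g, pullback.condition,
    fun a b h => ⟨pullback.lift a b h, pullback.lift_fst a b h, pullback.lift_snd a b h⟩,
    pullback.hom_ext⟩

end

namespace Cell

variable {K : Type u} [Bicategory.{w, w} K]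

/-- The interchange law, for two horizontally composable 2-cells. -/
lemma interchange {X Y Z : K} (c : Cell X Y) (d : Cell Y Z) :
    vcomp (post c d.src) (pre c.tgt d) = vcomp (pre c.src d) (post c d.tgt) := by
  refine (vcomp_of _ _).trans (Eq.trans ?_ (vcomp_of _ _).symm)
  rw [whisker_exchange]

/-- A left inverse of a 2-cell equals any right inverse. -/
lemma eq_of_inverse {X Y : K} {c d d' : Cell X Y} (h₁ : d.tgt = c.src) (h₂ : c.tgt = d'.src)
    (h : vcomp d c = idc d.src) (h' : vcomp c d' = idc c.src) : d = d' := by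
  have ht : d'.src = d.src := by
    have := congrArg Cell.tgt h
    rw [vcomp_tgt h₁] at this
    exact h₂.symm.trans this
  have h₃ : vcomp d (vcomp c d') = d := by rw [h', vcomp_idc]
  rw [← vcomp_assoc h₁ h₂, h, idc_vcomp ht.symm] at h₃
  exact h₃.symm

/-- Inverting two opposite sides of a commutative square of 2-cells gives a commutative square. -/
lemma square_inverse {X Y : K} {a a' b b' s t : Cell X Y} (e : vcomp a t = vcomp s b)
    (h₁ : a.tgt = t.src) (h₂ : s.tgt = b.src) (ha : a'.tgt = a.src)
    (hb : b'.src = b.tgt) (haa : vcomp a' a = idc a.tgt) (hbb : vcomp b b' = idc b.src) :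
    vcomp a' s = vcomp t b' := by
  have hs : a.src = s.src := by simpa using congrArg Cell.src e
  have ht : t.tgt = b.tgt := by
    rw [← vcomp_tgt h₁, e, vcomp_tgt h₂]
  calc vcomp a' s = vcomp a' (vcomp s (vcomp b b')) := by rw [hbb, vcomp_idc]
    _ = vcomp a' (vcomp (vcomp a t) b') := by rw [← vcomp_assoc h₂ hb.symm, e]
    _ = vcomp (vcomp (vcomp a' a) t) b' := by
      rw [vcomp_assoc (d := a) ha h₁,
        vcomp_assoc (c := a') (d := vcomp a t) (by simpa using ha) (by rw [vcomp_tgt h₁, ht, hb])]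
    _ = vcomp t b' := by rw [haa, idc_vcomp h₁]

/-- A 2-cell from `X` to `P` exhibits `P` as the tensor of `X` by the arrow category. The four
conditions spell out the isomorphism of categories `K(P, Y) ≅ K(X, Y)^𝟚`, on objects and on
morphisms. -/
structure IsArrowTensor {X P : K} (τ : Cell X P) : Prop where
  exists_desc : ∀ {Y : K} (d : Cell X Y), ∃ m : P ⟶ Y, post τ m = d
  hom_ext : ∀ {Y : K} {m m' : P ⟶ Y}, post τ m = post τ m' → m = m'
  exists_cell : ∀ {Y : K} (f g : P ⟶ Y) (α β : Cell X Y), α.src = τ.src ≫ f → α.tgt = τ.src ≫ g →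
    β.src = τ.tgt ≫ f → β.tgt = τ.tgt ≫ g → vcomp α (post τ g) = vcomp (post τ f) β →
    ∃ γ : Cell P Y, γ.src = f ∧ γ.tgt = g ∧ pre τ.src γ = α ∧ pre τ.tgt γ = β
  cell_ext : ∀ {Y : K} {γ γ' : Cell P Y}, γ.src = γ'.src → γ.tgt = γ'.tgt →
    pre τ.src γ = pre τ.src γ' → pre τ.tgt γ = pre τ.tgt γ' → γ = γ'

lemma exists_isArrowTensor (hK : HasArrowTensors K) (X : K) :
    ∃ (P : K) (τ : Cell X P), IsArrowTensor τ := by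
  obtain ⟨P, s, t, c, h⟩ := hK X
  refine ⟨P, of c, ⟨fun {Y} d => ?_, fun {Y m m'} e => ?_, fun {Y} f g α β hα hα' hβ hβ' e => ?_,
    fun {Y γ γ'} hs ht h₁ h₂ => ?_⟩⟩
  · obtain ⟨m, hm⟩ := (h Y).2.2.surjective (Arrow.mk d.hom)
    exact ⟨m, congrArg (fun a : Arrow (X ⟶ Y) => of a.hom) hm⟩
  · refine (h Y).2.2.injective ?_
    exact congrArg (fun a : Cell X Y => Arrow.mk a.hom) e
  · obtain ⟨α, rfl⟩ := exists_eq_of α hα hα'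
    obtain ⟨β, rfl⟩ := exists_eq_of β hβ hβ'
    have e' : α ≫ c ▷ g = c ▷ f ≫ β :=
      of_injective ((vcomp_of α (c ▷ g)).symm.trans (e.trans (vcomp_of (c ▷ f) β)))
    have := (h Y).1
    let φ : (tensorComparison c Y).obj f ⟶ (tensorComparison c Y).obj g := Arrow.homMk α β e'
    obtain ⟨γ, hγ⟩ := (tensorComparison c Y).map_surjective φ
    refine ⟨of γ, rfl, rfl, ?_, ?_⟩
    · exact congrArg (fun a : (tensorComparison c Y).obj f ⟶ (tensorComparison c Y).obj g =>
        of a.left) hγ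
    · exact congrArg (fun a : (tensorComparison c Y).obj f ⟶ (tensorComparison c Y).obj g =>
        of a.right) hγ
  · obtain ⟨f, g, γ⟩ := γ
    obtain ⟨f', g', γ'⟩ := γ'
    obtain rfl : f = f' := hs
    obtain rfl : g = g' := ht
    have := (h Y).2.1
    congr 1
    apply (tensorComparison c Y).map_injective
    ext
    · exact of_injective h₁
    · exact of_injective h₂

/-- A 2-cell out of a tensor is invertible if its restrictions to both ends are. -/
lemma IsArrowTensor.invertible {X P : K} {τ : Cell X P} (hτ : IsArrowTensor τ) {Y : K}
    {γ : Cell P Y} (h₁ : (pre τ.src γ).Invertible) (h₂ : (pre τ.tgt γ).Invertible) :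
    γ.Invertible := by
  obtain ⟨f, g, γ⟩ := γ
  have h₁' : IsIso (τ.src ◁ γ) := h₁
  have h₂' : IsIso (τ.tgt ◁ γ) := h₂
  obtain ⟨δ, h₃, h₄, h₅, h₆⟩ := hτ.exists_cell g f (of (inv (τ.src ◁ γ))) (of (inv (τ.tgt ◁ γ)))
    rfl rfl rfl rfl (by
      refine (vcomp_of _ (τ.hom ▷ f)).trans (Eq.trans ?_ (vcomp_of (τ.hom ▷ g) _).symm)
      congr 1
      exact (IsIso.inv_comp_eq _).2 (((IsIso.eq_comp_inv _).2 (whisker_exchange _ _).symm).trans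
        (Category.assoc _ _ _)))
  rw [invertible_iff]
  refine ⟨δ, h₃, h₄, hτ.cell_ext (vcomp_src _ _) ((vcomp_tgt (c := of γ) h₃.symm).trans h₄) ?_ ?_,
    hτ.cell_ext ((vcomp_src _ _).trans h₃) (vcomp_tgt (d := of γ) h₄) ?_ ?_⟩
  · rw [pre_vcomp _ h₃.symm, h₅, pre_idc]
    exact (vcomp_of (τ.src ◁ γ) _).trans (by simp [idc])
  · rw [pre_vcomp _ h₃.symm, h₆, pre_idc]
    exact (vcomp_of (τ.tgt ◁ γ) _).trans (by simp [idc])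
  · rw [pre_vcomp _ h₄, h₅, pre_idc]
    exact (vcomp_of _ (τ.src ◁ γ)).trans (by simp [idc])
  · rw [pre_vcomp _ h₄, h₆, pre_idc]
    exact (vcomp_of _ (τ.tgt ◁ γ)).trans (by simp [idc])

/-- A 2-cell `κ` is a universal 2-cell into `Y` or, if `Q` holds, a universal invertible 2-cell
into `Y`. -/
structure IsPath (Q : Prop) {P Y : K} (κ : Cell P Y) : Prop where
  invertible : Q → κ.Invertible
  exists_lift : ∀ {X : K} (d : Cell X Y), (Q → d.Invertible) → ∃ h : X ⟶ P, pre h κ = d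
  hom_ext : ∀ {X : K} {h h' : X ⟶ P}, pre h κ = pre h' κ → h = h'

lemma exists_isPath_false (hK : HasArrowCotensors K) (Y : K) :
    ∃ (P : K) (κ : Cell P Y), IsPath False κ := by
  obtain ⟨P, s, t, c, h⟩ := hK Y
  refine ⟨P, of c, fun hQ => hQ.elim, fun {X} d _ => ?_, fun {X m m'} e => ?_⟩
  · obtain ⟨m, hm⟩ := (h X).2.2.surjective (Arrow.mk d.hom)
    exact ⟨m, congrArg (fun a : Arrow (X ⟶ Y) => of a.hom) hm⟩
  · refine (h X).2.2.injective ?_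
    exact congrArg (fun a : Cell X Y => Arrow.mk a.hom) e

variable [Bicategory.Strict K]

/-- The universal invertible 2-cell is constructed from a universal 2-cell as a finite limit, by
adjoining an inverse. -/
lemma exists_isPath_true [HasFiniteLimits K] (hK : HasArrowCotensors K) (Y : K) :
    ∃ (P : K) (κ : Cell P Y), IsPath True κ := by
  obtain ⟨P, κ, hκ⟩ := exists_isPath_false hK Y
  -- the object of composable pairs of opposite 2-cells
  obtain ⟨PP, p₁, p₂, hp, hp'⟩ := exists_binary_product P P
  obtain ⟨E, e, he₁, he₂, hE, hE'⟩ :=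
    exists_joint_equalizer (p₁ ≫ κ.tgt) (p₂ ≫ κ.src) (p₂ ≫ κ.tgt) (p₁ ≫ κ.src)
  -- the locus where they are inverse to each other
  obtain ⟨m, hm⟩ := hκ.exists_lift (vcomp (pre (e ≫ p₁) κ) (pre (e ≫ p₂) κ)) False.elim
  obtain ⟨n, hn⟩ := hκ.exists_lift (vcomp (pre (e ≫ p₂) κ) (pre (e ≫ p₁) κ)) False.elim
  obtain ⟨m', hm'⟩ := hκ.exists_lift (idc (e ≫ p₁ ≫ κ.src)) False.elim
  obtain ⟨n', hn'⟩ := hκ.exists_lift (idc (e ≫ p₂ ≫ κ.src)) False.elim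
  obtain ⟨F, i, hi₁, hi₂, hF, hF'⟩ := exists_joint_equalizer m m' n n'
  have inv₁ : vcomp (pre (i ≫ e ≫ p₁) κ) (pre (i ≫ e ≫ p₂) κ) = idc (i ≫ e ≫ p₁ ≫ κ.src) := by
    have := congrArg (pre · κ) hi₁
    simp only [← pre_pre] at this
    rw [hm, hm', pre_vcomp _ (by simpa using he₁)] at this
    simpa using this
  have inv₂ : vcomp (pre (i ≫ e ≫ p₂) κ) (pre (i ≫ e ≫ p₁) κ) = idc (i ≫ e ≫ p₂ ≫ κ.src) := by
    have := congrArg (pre · κ) hi₂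
    simp only [← pre_pre] at this
    rw [hn, hn', pre_vcomp _ (by simpa using he₂)] at this
    simpa using this
  have hie₁ : i ≫ e ≫ p₁ ≫ κ.tgt = i ≫ e ≫ p₂ ≫ κ.src := by rw [he₁]
  have hie₂ : i ≫ e ≫ p₂ ≫ κ.tgt = i ≫ e ≫ p₁ ≫ κ.src := by rw [he₂]
  refine ⟨_, pre (i ≫ e ≫ p₁) κ, fun _ => ?_, fun {X} d hd => ?_, fun {X h h'} hh => ?_⟩
  · rw [invertible_iff]
    exact ⟨pre (i ≫ e ≫ p₂) κ, by simp [hie₁], by simp [hie₂], by simpa using inv₁,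
      by simpa [hie₁] using inv₂⟩
  · obtain ⟨d', h₁, h₂, h₃, h₄⟩ := invertible_iff.1 (hd trivial)
    obtain ⟨k, rfl⟩ := hκ.exists_lift d False.elim
    obtain ⟨k', rfl⟩ := hκ.exists_lift d' False.elim
    simp only [pre_src, pre_tgt] at h₁ h₂ h₃ h₄
    obtain ⟨kk, hkk, hkk'⟩ := hp k k'
    obtain ⟨l, hl⟩ := hE kk (by rw [reassoc_of% hkk, reassoc_of% hkk', h₁])
      (by rw [reassoc_of% hkk, reassoc_of% hkk', h₂])
    have hl₁ : l ≫ e ≫ p₁ = k := by rw [reassoc_of% hl, hkk]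
    have hl₂ : l ≫ e ≫ p₂ = k' := by rw [reassoc_of% hl, hkk']
    have hl₁' : l ≫ e ≫ p₁ ≫ κ.src = k ≫ κ.src := by rw [reassoc_of% hl₁]
    have hl₂' : l ≫ e ≫ p₂ ≫ κ.src = k' ≫ κ.src := by rw [reassoc_of% hl₂]
    have hlm : l ≫ m = l ≫ m' := hκ.hom_ext (by
      rw [← pre_pre, ← pre_pre, hm, hm', pre_vcomp _ (by simpa using he₁)]
      simp [hl₁, hl₂, hl₁', h₃])
    have hln : l ≫ n = l ≫ n' := hκ.hom_ext (by
      rw [← pre_pre, ← pre_pre, hn, hn', pre_vcomp _ (by simpa using he₂)]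
      simp [hl₁, hl₂, hl₂', h₁, h₄])
    obtain ⟨r, hr⟩ := hF l hlm hln
    exact ⟨r, by rw [pre_pre, reassoc_of% hr, hl₁]⟩
  · rw [pre_pre, pre_pre] at hh
    have h₁ := hκ.hom_ext hh
    have h₂ : h ≫ i ≫ e ≫ p₂ = h' ≫ i ≫ e ≫ p₂ := hκ.hom_ext (by
      refine eq_of_inverse (c := pre (h ≫ i ≫ e ≫ p₁) κ) ?_ ?_ ?_ ?_
      · simp [hie₂]
      · rw [h₁]
        simp [hie₁]
      · have := congrArg (pre h) inv₂
        rw [pre_vcomp _ (by simpa using hie₂)] at this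
        simpa using this
      · have := congrArg (pre h') inv₁
        rw [pre_vcomp _ (by simpa using hie₁)] at this
        rw [h₁]
        simpa using this)
    exact hF' (hE' (hp' (by simpa using h₁) (by simpa using h₂)))

lemma exists_isPath [HasFiniteLimits K] (hK : HasArrowCotensors K) (Q : Prop) (Y : K) :
    ∃ (P : K) (κ : Cell P Y), IsPath Q κ := by
  by_cases hQ : Q
  · rw [eq_true hQ]
    exact exists_isPath_true hK Y
  · rw [eq_false hQ]
    exact exists_isPath_false hK Y

/-- The universal 2-cell `c : u ≫ g ⟶ v` (the comma object of `g` and the identity) or, if `Q`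
holds, the universal invertible such 2-cell (the pseudolimit of `g`). Only the one-dimensional
universal property is required. -/
structure IsComma (Q : Prop) {L X Y : K} (g : X ⟶ Y) (u : L ⟶ X) (c : Cell L Y) : Prop where
  src : c.src = u ≫ g
  invertible : Q → c.Invertible
  exists_lift : ∀ {Z : K} (x : Z ⟶ X) (d : Cell Z Y), d.src = x ≫ g → (Q → d.Invertible) →
    ∃ h : Z ⟶ L, h ≫ u = x ∧ pre h c = d
  hom_ext : ∀ {Z : K} {h h' : Z ⟶ L}, h ≫ u = h' ≫ u → pre h c = pre h' c → h = h'

lemma exists_isComma [HasFiniteLimits K] (hK : HasArrowCotensors K) (Q : Prop) {X Y : K}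
    (g : X ⟶ Y) : ∃ (L : K) (u : L ⟶ X) (c : Cell L Y), IsComma Q g u c := by
  obtain ⟨P, κ, hκ⟩ := exists_isPath hK Q Y
  obtain ⟨L, p, q, hpq, hL, hL'⟩ := exists_pullback g κ.src
  refine ⟨L, p, pre q κ, hpq.symm, fun hQ => (hκ.invertible hQ).pre _,
    fun {Z} x d hd hQ => ?_, fun {Z h h'} h₁ h₂ => hL' h₁ (hκ.hom_ext ?_)⟩
  · obtain ⟨k, rfl⟩ := hκ.exists_lift d hQ
    obtain ⟨l, h₁, h₂⟩ := hL x k hd.symm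
    exact ⟨l, h₁, by rw [pre_pre, h₂]⟩
  · simpa using h₂

namespace IsComma

variable {Q : Prop} {L X Y : K} {g : X ⟶ Y} {u : L ⟶ X} {c : Cell L Y}

/-- The two-dimensional universal property of a comma object follows from the one-dimensional one
in the presence of tensors. -/
lemma exists_cell (hc : IsComma Q g u c) (hK : HasArrowTensors K) {Z : K} (h h' : Z ⟶ L)
    (α : Cell Z X) (β : Cell Z Y) (hα : α.src = h ≫ u) (hα' : α.tgt = h' ≫ u)
    (hβ : β.src = h ≫ c.tgt) (hβ' : β.tgt = h' ≫ c.tgt)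
    (e : vcomp (post α g) (pre h' c) = vcomp (pre h c) β) :
    ∃ γ : Cell Z L, γ.src = h ∧ γ.tgt = h' ∧ post γ u = α ∧ post γ c.tgt = β := by
  obtain ⟨P, τ, hτ⟩ := exists_isArrowTensor hK Z
  -- the pair `(α, β)` is a morphism of 2-cells, that is, a 2-cell `φ` between 1-cells out of the
  -- tensor of `Z`; the one-dimensional universal property applies to `φ`
  obtain ⟨a, ha⟩ := hτ.exists_desc α
  obtain ⟨b, hb⟩ := hτ.exists_desc β
  have ha₁ : τ.src ≫ a = h ≫ u := (congrArg Cell.src ha).trans hα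
  have ha₂ : τ.tgt ≫ a = h' ≫ u := (congrArg Cell.tgt ha).trans hα'
  have hb₁ : τ.src ≫ b = h ≫ c.tgt := (congrArg Cell.src hb).trans hβ
  have hb₂ : τ.tgt ≫ b = h' ≫ c.tgt := (congrArg Cell.tgt hb).trans hβ'
  obtain ⟨φ, h₁, h₂, h₃, h₄⟩ := hτ.exists_cell (a ≫ g) b (pre h c) (pre h' c)
    (by rw [reassoc_of% ha₁, pre_src, hc.src]) (by simp [hb₁])
    (by rw [reassoc_of% ha₂, pre_src, hc.src]) (by simp [hb₂])
    (by rw [hb, ← e, ← post_post, ha])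
  obtain ⟨m, hm, hm'⟩ := hc.exists_lift a φ h₁ fun hQ =>
    hτ.invertible (by rw [h₃]; exact (hc.invertible hQ).pre _)
      (by rw [h₄]; exact (hc.invertible hQ).pre _)
  refine ⟨post τ m, ?_, ?_, ?_, ?_⟩
  · apply hc.hom_ext
    · simp [hm, ha₁]
    · rw [post_src, ← pre_pre, hm', h₃]
  · apply hc.hom_ext
    · simp [hm, ha₂]
    · rw [post_tgt, ← pre_pre, hm', h₄]
  · rw [post_post, hm, ha]
  · have := congrArg Cell.tgt hm'
    rw [pre_tgt, h₂] at this
    rw [post_post, this, hb]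

/-- A 2-cell into a comma object is determined by its composites with the two projections. -/
lemma cell_ext (hc : IsComma Q g u c) (hK : HasArrowTensors K) {Z : K} {γ γ' : Cell Z L}
    (hs : γ.src = γ'.src) (ht : γ.tgt = γ'.tgt) (h₁ : post γ u = post γ' u)
    (h₂ : post γ c.tgt = post γ' c.tgt) : γ = γ' := by
  obtain ⟨P, τ, hτ⟩ := exists_isArrowTensor hK Z
  obtain ⟨m, rfl⟩ := hτ.exists_desc γ
  obtain ⟨m', rfl⟩ := hτ.exists_desc γ'
  rw [post_post, post_post] at h₁ h₂
  have h₁' := hτ.hom_ext h₁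
  have h₂' := hτ.hom_ext h₂
  congr 1
  apply hc.hom_ext h₁'
  apply hτ.cell_ext
  · rw [pre_src, pre_src, hc.src, reassoc_of% h₁']
  · exact h₂'
  · rw [pre_pre, pre_pre]
    exact congrArg (pre · c) hs
  · rw [pre_pre, pre_pre]
    exact congrArg (pre · c) ht

/-- The projections of a comma object jointly reflect invertibility of 2-cells. -/
lemma invertible_of_post (hc : IsComma Q g u c) (hK : HasArrowTensors K) {Z : K} {γ : Cell Z L}
    (h₁ : (post γ u).Invertible) (h₂ : (post γ c.tgt).Invertible) : γ.Invertible := by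
  obtain ⟨α, hα, hα', hαα, hαα'⟩ := invertible_iff.1 h₁
  obtain ⟨β, hβ, hβ', hββ, hββ'⟩ := invertible_iff.1 h₂
  simp only [post_src, post_tgt] at hα hα' hαα hαα' hβ hβ' hββ hββ'
  have e := interchange γ c
  rw [hc.src, ← post_post] at e
  obtain ⟨δ, h₃, h₄, h₅, h₆⟩ := hc.exists_cell hK γ.tgt γ.src α β hα hα' hβ hβ'
    (square_inverse e (by simp [hc.src]) (by simp) (by simp [reassoc_of% hα'])
      hβ (by
        rw [← post_vcomp (by simpa using hα'), hαα']
        simp) (by simpa using hββ))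
  rw [invertible_iff]
  refine ⟨δ, h₃, h₄, hc.cell_ext hK ?_ ?_ ?_ ?_, hc.cell_ext hK ?_ ?_ ?_ ?_⟩
  · simp
  · simp [vcomp_tgt h₃.symm, h₄]
  · rw [post_vcomp h₃.symm, h₅, hαα, post_idc]
  · rw [post_vcomp h₃.symm, h₆, hββ, post_idc]
  · simp [h₃]
  · simp [vcomp_tgt h₄]
  · rw [post_vcomp h₄, h₅, hαα', post_idc]
  · rw [post_vcomp h₄, h₆, hββ', post_idc]

end IsComma

end Cell

/-! ### Comma objects of pseudomorphisms -/

namespace TwoMonad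

open Cell

variable {K : Type u} [Bicategory.{w, w} K] [Bicategory.Strict K] {T : TwoMonad K}

namespace PseudoHom

variable {A B : T.AlgS} (p : PseudoHom A B)

/-- The inverse of the structure 2-cell of a pseudo `T`-morphism. -/
def invCell : Cell (T.toMonad.obj A.A) B.A := of p.iso.inv

@[simp] lemma invCell_src : p.invCell.src = A.a ≫ p.f := rfl
@[simp] lemma invCell_tgt : p.invCell.tgt = T.toMonad.map p.f ≫ B.a := rfl

lemma invertible_invCell : p.invCell.Invertible := inferInstanceAs (IsIso p.iso.inv)

lemma cell_invCell : vcomp p.cell p.invCell = idc (T.toMonad.map p.f ≫ B.a) :=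
  (vcomp_of _ _).trans (by rw [Iso.hom_inv_id]; rfl)

lemma invCell_cell : vcomp p.invCell p.cell = idc (A.a ≫ p.f) :=
  (vcomp_of _ _).trans (by rw [Iso.inv_hom_id]; rfl)

@[simp] lemma pre_η_invCell : pre (T.toMonad.η.app A.A) p.invCell = idc p.f := by
  have h := congrArg (pre (T.toMonad.η.app A.A)) p.cell_invCell
  rw [pre_vcomp _ rfl, pre_η_cell, idc_vcomp] at h
  · rw [h, pre_idc]
    exact congrArg idc (B.eta_map_a p.f)
  · exact (congrArg Cell.tgt p.pre_η_cell).symm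

end PseudoHom

lemma map_a_a (A : T.AlgS) : T.toMonad.map A.a ≫ A.a = T.toMonad.μ.app A.A ≫ A.a := A.assoc.symm

lemma PseudoHom.pre_μ_invCell {A B : T.AlgS} (p : PseudoHom A B) :
    pre (T.toMonad.μ.app A.A) p.invCell =
      vcomp (pre (T.toMonad.map A.a) p.invCell) (post (T.cell p.invCell) B.a) := by
  refine eq_of_inverse (c := pre (T.toMonad.μ.app A.A) p.cell) rfl ?_ ?_ ?_
  · simp only [pre_tgt, cell_tgt, vcomp_src, pre_src, invCell_src]
    exact (pseudo_mul_aux₃ p.f).symm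
  · rw [← pre_vcomp _ rfl, invCell_cell, pre_idc]
    rfl
  · rw [p.pre_μ_cell, vcomp_assoc (by simp) (by simp),
      ← vcomp_assoc (c := pre _ p.cell) rfl (by simp), ← pre_vcomp _ rfl, cell_invCell, pre_idc,
      idc_vcomp (by simp), ← post_vcomp rfl, ← cell_vcomp rfl, cell_invCell]
    simp

/-- The (`Q`-invertible) comma object of a pseudo `T`-morphism lifts to strict `T`-algebras, with
strict projections: the action on the universal 2-cell is defined by pasting with the inverse of the
structure 2-cell of the pseudo morphism. -/
lemma exists_commaAlgebra [HasFiniteLimits K] (hK : HasArrowCotensors K) (Q : Prop) {A B : T.AlgS}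
    (p : PseudoHom A B) : ∃ (L : T.AlgS) (u : L ⟶ A) (v : L ⟶ B) (c : Cell L.A B.A),
      IsComma Q p.f u.f c ∧ c.tgt = v.f ∧
        pre L.a c = vcomp (pre (T.toMonad.map u.f) p.invCell) (post (T.cell c) B.a) := by
  obtain ⟨L, u, c, hc⟩ := exists_isComma hK Q p.f
  have e₁ : (T.toMonad.map u ≫ T.toMonad.map p.f ≫ B.a) = T.toMonad.map c.src ≫ B.a := by
    rw [hc.src, Functor.map_comp, Category.assoc]
  obtain ⟨l, hl, hl'⟩ := hc.exists_lift (T.toMonad.map u ≫ A.a)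
    (vcomp (pre (T.toMonad.map u) p.invCell) (post (T.cell c) B.a)) (by simp) fun hQ =>
      (p.invertible_invCell.pre _).vcomp ((hc.invertible hQ).cell.post _)
  have hv : T.toMonad.map c.tgt ≫ B.a = l ≫ c.tgt := by
    have := congrArg Cell.tgt hl'
    rw [vcomp_tgt (by simpa using e₁)] at this
    exact this.symm
  have hlu : l ≫ u = T.toMonad.map u ≫ A.a := hl
  -- the laws of an algebra are those of `A` after projecting by `u`, and those of `p` and `B` for
  -- the universal 2-cell
  let LL : T.AlgS :=
    { A := L
      a := l
      unit := by
        apply hc.hom_ext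
        · rw [Category.assoc, hlu]
          exact (A.eta_map_a u).trans (Category.id_comp u).symm
        · rw [← pre_pre, hl', pre_vcomp _ (by simpa using e₁), pre_pre, pre_post, pre_η_cell,
            post_post, B.unit, ← Monad.unit_naturality, ← pre_pre, PseudoHom.pre_η_invCell,
            pre_idc, idc_vcomp (by simpa using hc.src.symm)]
          exact (post_id c).trans (pre_id c).symm
      assoc := by
        have e₂ : T.toMonad.map l ≫ T.toMonad.map u =
            T.toMonad.map (T.toMonad.map u) ≫ T.toMonad.map A.a := by
          rw [← Functor.map_comp, ← Functor.map_comp, hlu]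
        apply hc.hom_ext
        · rw [Category.assoc, Category.assoc, hlu, reassoc_of% e₂, map_a_a,
            Monad.mu_naturality_assoc]
        · have e₃ := congrArg T.cell hl'
          rw [cell_pre, cell_vcomp (by simpa using e₁), cell_pre, cell_post] at e₃
          have e₄ : T.toMonad.map (T.toMonad.map u) ≫ T.toMonad.map (T.toMonad.map p.f ≫ B.a) =
              T.toMonad.map (T.toMonad.map c.src) ≫ T.toMonad.map B.a := by
            rw [← Functor.map_comp, e₁, Functor.map_comp]
          rw [← pre_pre, hl', pre_vcomp _ (by simpa using e₁), pre_pre, pre_post, pre_μ_cell,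
            post_post, B.assoc, ← Monad.mu_naturality, ← pre_pre, p.pre_μ_invCell,
            pre_vcomp _ (by simp), pre_pre, pre_post, vcomp_assoc (by simp)]
          · refine Eq.trans ?_ (pre_pre _ _ _)
            rw [hl', pre_vcomp _ (by simpa using e₁), pre_pre, e₂, pre_post, e₃,
              post_vcomp e₄, post_post]
          · rw [post_tgt, pre_tgt, post_src, Category.assoc]
            exact (Category.assoc _ _ _).symm.trans
              ((e₄ =≫ B.a).trans (Category.assoc _ _ _)) }
  exact ⟨LL, ⟨u, hl.symm⟩, ⟨c.tgt, hv⟩, c, hc, rfl, hl'⟩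

/-- The comma object of a pseudo `T`-morphism is universal with respect to pseudo
`T`-morphisms into it. The hypothesis `e` says that `φ` is a `T`-transformation from the composite
of `x` and `p` to `y`. -/
lemma exists_pseudoHom_commaAlgebra (hK : HasArrowTensors K) {Q : Prop} {A B L E : T.AlgS}
    {p : PseudoHom A B} {u : L ⟶ A} {v : L ⟶ B} {c : Cell L.A B.A} (hc : IsComma Q p.f u.f c)
    (hv : c.tgt = v.f)
    (hL : pre L.a c = vcomp (pre (T.toMonad.map u.f) p.invCell) (post (T.cell c) B.a))
    (x : PseudoHom E A) (y : PseudoHom E B) (φ : Cell E.A B.A) (hs : φ.src = x.f ≫ p.f)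
    (ht : φ.tgt = y.f) (hφ : Q → φ.Invertible)
    (e : vcomp (post (T.cell φ) B.a) y.cell =
      vcomp (vcomp (pre (T.toMonad.map x.f) p.cell) (post x.cell p.f)) (pre E.a φ)) :
    ∃ k : PseudoHom E L, k.compStrict u = x ∧ k.compStrict v = y ∧ pre k.f c = φ := by
  obtain ⟨k, hk, hk'⟩ := hc.exists_lift x.f φ hs hφ
  have hkv : k ≫ c.tgt = y.f := (congrArg Cell.tgt hk').trans ht
  have hTk : T.toMonad.map k ≫ T.toMonad.map u.f = T.toMonad.map x.f := by
    rw [← Functor.map_comp, hk]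
  have hTkv : T.toMonad.map k ≫ T.toMonad.map c.tgt = T.toMonad.map y.f := by
    rw [← Functor.map_comp, hkv]
  have hLu : L.a ≫ u.f = T.toMonad.map u.f ≫ A.a := u.h.symm
  have hLv : L.a ≫ c.tgt = T.toMonad.map c.tgt ≫ B.a := by rw [hv]; exact v.h.symm
  have e₁ : (T.toMonad.map u.f ≫ T.toMonad.map p.f ≫ B.a) = T.toMonad.map c.src ≫ B.a := by
    rw [hc.src, Functor.map_comp, Category.assoc]
  have e₂ : (T.toMonad.map x.f ≫ T.toMonad.map p.f ≫ B.a) = T.toMonad.map φ.src ≫ B.a := by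
    rw [hs, Functor.map_comp, Category.assoc]
  have e₃ : pre (T.toMonad.map k ≫ L.a) c =
      vcomp (pre (T.toMonad.map x.f) p.invCell) (post (T.cell φ) B.a) := by
    rw [← pre_pre, hL, pre_vcomp _ (by simpa using e₁), pre_pre, hTk, pre_post, ← cell_pre, hk']
  obtain ⟨γ, h₁, h₂, h₃, h₄⟩ := hc.exists_cell hK (T.toMonad.map k ≫ L.a) (E.a ≫ k) x.cell y.cell
    (by rw [Category.assoc, hLu, reassoc_of% hTk, PseudoHom.cell_src])
    (by rw [Category.assoc, hk, PseudoHom.cell_tgt])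
    (by rw [Category.assoc, hLv, reassoc_of% hTkv, PseudoHom.cell_src])
    (by rw [Category.assoc, hkv, PseudoHom.cell_tgt])
    (by
      rw [e₃, ← pre_pre, hk', vcomp_assoc (by simpa using e₂) (by simp [ht]), e,
        vcomp_assoc, ← vcomp_assoc, ← pre_vcomp _ rfl, p.invCell_cell, pre_idc, idc_vcomp]
      all_goals simp [hs])
  have e₄ : T.toMonad.map γ.tgt ≫ L.a = T.toMonad.map E.a ≫ γ.src := by
    rw [h₁, h₂]
    exact pseudo_mul_aux₂ (A := E) (B := L) k
  obtain ⟨k', rfl, hkc⟩ := PseudoHom.exists_of_cell (A := E) (B := L) k γ h₁ h₂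
    (hc.invertible_of_post hK (by rw [h₃]; exact x.invertible_cell)
      (by rw [h₄]; exact y.invertible_cell))
    (by
      apply hc.cell_ext hK
      · rw [pre_src, h₁]
        exact L.eta_map_a k
      · rw [pre_tgt, h₂]
        exact (E.unit_assoc k)
      · rw [← pre_post, h₃, PseudoHom.pre_η_cell, post_idc, hk]
      · rw [← pre_post, h₄, PseudoHom.pre_η_cell, post_idc, hkv])
    (by
      apply hc.cell_ext hK
      · rw [pre_src, vcomp_src, post_src, cell_src, h₁]
        exact pseudo_mul_aux₁ k
      · rw [vcomp_tgt e₄, pre_tgt, pre_tgt, h₂]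
        exact (pseudo_mul_aux₃ k).symm
      · rw [← pre_post, h₃, PseudoHom.pre_μ_cell, post_vcomp e₄, post_post, hLu, ← post_post,
          ← cell_post, ← pre_post, h₃]
      · rw [← pre_post, h₄, PseudoHom.pre_μ_cell, post_vcomp e₄, post_post, hLv, ← post_post,
          ← cell_post, ← pre_post, h₄])
  refine ⟨k', PseudoHom.ext_cell hk ?_, PseudoHom.ext_cell ?_ ?_, hk'⟩
  · rw [PseudoHom.compStrict_cell, hkc, h₃]
  · rw [PseudoHom.compStrict_f, ← hv, hkv]
  · rw [PseudoHom.compStrict_cell, hkc, ← hv, h₄]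

end TwoMonad

/-! ### Free algebras subject to equations -/

lemma exists_binary_coproduct {C : Type*} [Category* C] [HasBinaryCoproducts C] (X Y : C) :
    ∃ (P : C) (i : X ⟶ P) (j : Y ⟶ P),
      (∀ {Z : C} (f : X ⟶ Z) (g : Y ⟶ Z), ∃ h : P ⟶ Z, i ≫ h = f ∧ j ≫ h = g) ∧
      ∀ {Z : C} {h h' : P ⟶ Z}, i ≫ h = i ≫ h' → j ≫ h = j ≫ h' → h = h' :=
  ⟨X ⨿ Y, coprod.inl, coprod.inr,
    fun f g => ⟨coprod.desc f g, coprod.inl_desc f g, coprod.inr_desc f g⟩, coprod.hom_ext⟩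

lemma CategoryTheory.Monad.exists_free_algebra {C : Type*} [Category* C] (T : Monad C) (X : C) :
    ∃ (F : T.Algebra) (i : X ⟶ F.A), ∀ {B : T.Algebra} (g : X ⟶ B.A),
      ∃! u : F ⟶ B, i ≫ u.f = g := by
  refine ⟨T.free.obj X, T.η.app X, fun {B} g => ?_⟩
  obtain ⟨u, hu, hu'⟩ := (T.adj.homEquiv X B).bijective.existsUnique g
  simp only [Adjunction.homEquiv_unit, Monad.adj_unit] at hu hu'
  exact ⟨u, hu, hu'⟩

namespace TwoMonad

open Cell

variable {K : Type u} [Bicategory.{w, w} K] [Bicategory.Strict K] {T : TwoMonad K}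

/-- Imposing an equation between 2-cells on an algebra. -/
lemma exists_quotient_of_cell_eq [HasCoequalizers T.AlgS] (hK : HasArrowTensors K) (D : T.AlgS)
    {R : K} (c c' : Cell R D.A) : ∃ (D' : T.AlgS) (q : D ⟶ D'), post c q.f = post c' q.f ∧
      ∀ {B : T.AlgS} (v : D ⟶ B), post c v.f = post c' v.f → ∃! w : D' ⟶ B, q ≫ w = v := by
  obtain ⟨P, τ, hτ⟩ := exists_isArrowTensor hK R
  obtain ⟨r, rfl⟩ := hτ.exists_desc c
  obtain ⟨r', rfl⟩ := hτ.exists_desc c'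
  obtain ⟨F, i, hF⟩ := T.toMonad.exists_free_algebra P
  obtain ⟨s, hs, -⟩ := hF r
  obtain ⟨s', hs', -⟩ := hF r'
  have key {B : T.AlgS} (v : D ⟶ B) :
      s ≫ v = s' ≫ v ↔ post (post τ r) v.f = post (post τ r') v.f := by
    rw [post_post, post_post]
    constructor
    · intro h
      have : r ≫ v.f = r' ≫ v.f := by
        rw [← hs, ← hs']
        exact (Category.assoc _ _ _).trans ((congrArg (fun z => i ≫ z.f) h).trans
          (Category.assoc _ _ _).symm)
      rw [this]
    · intro h
      refine (hF (r ≫ v.f)).unique ?_ ?_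
      · rw [← hs]
        exact (Category.assoc _ _ _).symm
      · rw [hτ.hom_ext h, ← hs']
        exact (Category.assoc _ _ _).symm
  refine ⟨_, coequalizer.π s s', (key _).1 (coequalizer.condition s s'), fun v hv =>
    ⟨coequalizer.desc v ((key v).2 hv), coequalizer.π_desc _ _, fun w hw =>
      coequalizer.hom_ext (hw.trans (coequalizer.π_desc _ _).symm)⟩⟩

/-- Imposing finitely many equations between 2-cells on an algebra. Equations between 1-cells are
included as equations between identity 2-cells. -/
lemma exists_quotient [HasCoequalizers T.AlgS] (hK : HasArrowTensors K) (D : T.AlgS)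
    (l : List (Σ R : K, Cell R D.A × Cell R D.A)) : ∃ (D' : T.AlgS) (q : D ⟶ D'),
      (∀ e ∈ l, post e.2.1 q.f = post e.2.2 q.f) ∧
      ∀ {B : T.AlgS} (v : D ⟶ B), (∀ e ∈ l, post e.2.1 v.f = post e.2.2 v.f) →
        ∃! w : D' ⟶ B, q ≫ w = v := by
  induction hn : l.length generalizing D with
  | zero =>
    obtain rfl := List.length_eq_zero_iff.1 hn
    exact ⟨D, 𝟙 D, by simp, fun v _ => ⟨v, Category.id_comp v, fun w hw =>
      (Category.id_comp w).symm.trans hw⟩⟩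
  | succ n ih =>
    obtain ⟨⟨R, c, c'⟩, l, rfl⟩ := List.exists_cons_of_length_eq_add_one hn
    obtain ⟨D₁, q₁, h₁, hq₁⟩ := exists_quotient_of_cell_eq hK D c c'
    obtain ⟨D₂, q₂, h₂, hq₂⟩ := ih D₁ (l.map fun e : (Σ R : K, Cell R D.A × Cell R D.A) =>
      ⟨e.1, post e.2.1 q₁.f, post e.2.2 q₁.f⟩) (by simpa using hn)
    simp only [List.forall_mem_map, post_post] at h₂ hq₂
    simp only [List.forall_mem_cons]
    refine ⟨D₂, q₁ ≫ q₂, ⟨?_, h₂⟩, fun {B} v hv => ?_⟩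
    · have := congrArg (post · q₂.f) h₁
      simp only [post_post] at this
      exact this
    · obtain ⟨w, rfl, hw⟩ := hq₁ v hv.1
      obtain ⟨w', rfl, hw'⟩ := hq₂ w hv.2
      refine ⟨w', Category.assoc _ _ _, fun z hz => hw' z ?_⟩
      exact hw _ ((Category.assoc _ _ _).symm.trans hz)

/-- The free algebra on a 1-cell out of `X` and two 2-cells between 1-cells out of `Y`. -/
lemma exists_free_pseudoHom_data [HasBinaryCoproducts K] (hK : HasArrowTensors K) (T : TwoMonad K)
    (X Y : K) : ∃ (D : T.AlgS) (f : X ⟶ D.A) (φ ψ : Cell Y D.A),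
      ∀ {B : T.AlgS} (f' : X ⟶ B.A) (φ' ψ' : Cell Y B.A),
        ∃! v : D ⟶ B, f ≫ v.f = f' ∧ post φ v.f = φ' ∧ post ψ v.f = ψ' := by
  obtain ⟨P, τ, hτ⟩ := exists_isArrowTensor hK Y
  obtain ⟨S, i, j, hS, hS'⟩ := exists_binary_coproduct P P
  obtain ⟨Z, k, l, hZ, hZ'⟩ := exists_binary_coproduct X S
  obtain ⟨F, m, hF⟩ := T.toMonad.exists_free_algebra Z
  refine ⟨F, k ≫ m, post τ (i ≫ l ≫ m), post τ (j ≫ l ≫ m), fun {B} f' φ' ψ' => ?_⟩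
  obtain ⟨a, rfl⟩ := hτ.exists_desc φ'
  obtain ⟨b, rfl⟩ := hτ.exists_desc ψ'
  obtain ⟨c, rfl, rfl⟩ := hS a b
  obtain ⟨d, rfl, rfl⟩ := hZ f' c
  obtain ⟨v, hv, hv'⟩ := hF d
  refine ⟨v, ⟨?_, ?_, ?_⟩, fun v' ⟨h₁, h₂, h₃⟩ => hv' v' ?_⟩
  · rw [Category.assoc, hv]
  · rw [post_post, Category.assoc, Category.assoc, hv]
  · rw [post_post, Category.assoc, Category.assoc, hv]
  · have h₂' := hτ.hom_ext ((post_post _ _ _).symm.trans h₂)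
    have h₃' := hτ.hom_ext ((post_post _ _ _).symm.trans h₃)
    simp only [Category.assoc] at h₁ h₂' h₃'
    exact hZ' h₁ (hS' h₂' h₃')

lemma comp_comp_f {X : K} {A B C : T.AlgS} (f : X ⟶ A.A) (u : A ⟶ B) (v : B ⟶ C) :
    (f ≫ u.f) ≫ v.f = f ≫ (u ≫ v).f := Category.assoc _ _ _

lemma map_comp_a {X : K} {A B : T.AlgS} (f : X ⟶ A.A) (u : A ⟶ B) :
    T.toMonad.map f ≫ A.a ≫ u.f = T.toMonad.map (f ≫ u.f) ≫ B.a := by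
  rw [Functor.map_comp, Category.assoc, u.h]

/-- The universal strict algebra with a 1-cell from `A.A` and a pair of opposite 2-cells between the
1-cells that the structure 2-cell of a pseudo `T`-morphism relates. -/
lemma exists_universal_opposite_cells [HasBinaryCoproducts K] [HasCoequalizers T.AlgS]
    (hK : HasArrowTensors K) (A : T.AlgS) :
    ∃ (D : T.AlgS) (f : A.A ⟶ D.A) (φ ψ : Cell (T.toMonad.obj A.A) D.A),
      φ.src = T.toMonad.map f ≫ D.a ∧ φ.tgt = A.a ≫ f ∧
      ψ.src = A.a ≫ f ∧ ψ.tgt = T.toMonad.map f ≫ D.a ∧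
      ∀ {B : T.AlgS} (f' : A.A ⟶ B.A) (φ' ψ' : Cell (T.toMonad.obj A.A) B.A),
        φ'.src = T.toMonad.map f' ≫ B.a → φ'.tgt = A.a ≫ f' →
        ψ'.src = A.a ≫ f' → ψ'.tgt = T.toMonad.map f' ≫ B.a →
        ∃! v : D ⟶ B, f ≫ v.f = f' ∧ post φ v.f = φ' ∧ post ψ v.f = ψ' := by
  obtain ⟨D, f, φ, ψ, hD⟩ := exists_free_pseudoHom_data hK T A.A (T.toMonad.obj A.A)
  obtain ⟨D₁, q, h, hq⟩ := exists_quotient hK D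
    [⟨_, idc φ.src, idc (T.toMonad.map f ≫ D.a)⟩, ⟨_, idc φ.tgt, idc (A.a ≫ f)⟩,
      ⟨_, idc ψ.src, idc (A.a ≫ f)⟩, ⟨_, idc ψ.tgt, idc (T.toMonad.map f ≫ D.a)⟩]
  have idc_inj {X Y : K} {f g : X ⟶ Y} : idc f = idc g ↔ f = g :=
    ⟨fun h => congrArg Cell.src h, fun h => congrArg idc h⟩
  simp only [List.forall_mem_cons, List.not_mem_nil, post_idc, idc_inj, map_comp_a, false_implies,
    implies_true, and_true, ← post_src, ← post_tgt, Category.assoc] at h hq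
  obtain ⟨hφ, hφ', hψ, hψ'⟩ := h
  refine ⟨D₁, f ≫ q.f, post φ q.f, post ψ q.f, hφ, hφ', hψ, hψ', ?_⟩
  rintro B f' φ' ψ' h₁ h₂ h₃ h₄
  obtain ⟨v, ⟨rfl, rfl, rfl⟩, hv⟩ := hD f' φ' ψ'
  obtain ⟨w, rfl, hw⟩ := hq v ⟨h₁, h₂, h₃, h₄⟩
  refine ⟨w, ⟨comp_comp_f _ _ _, post_post _ _ _, post_post _ _ _⟩, fun z ⟨hz, hz', hz''⟩ => ?_⟩
  refine hw z (hv (q ≫ z) ⟨(comp_comp_f _ _ _).symm.trans hz, (post_post _ _ _).symm.trans hz',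
    (post_post _ _ _).symm.trans hz''⟩)

/-- The one-dimensional universal property of `A'`: it is presented by a 1-cell out of `A.A`, two
2-cells between 1-cells out of `T A.A`, and the equations saying that these are mutually inverse
and form a pseudo `T`-morphism. -/
lemma exists_universal_pseudoHom [HasBinaryCoproducts K] [HasCoequalizers T.AlgS]
    (hK : HasArrowTensors K) (A : T.AlgS) : ∃ (D : T.AlgS) (p : PseudoHom A D),
      ∀ {B : T.AlgS} (y : PseudoHom A B), ∃! v : D ⟶ B, p.compStrict v = y := by
  obtain ⟨D, f, φ, ψ, hφ, hφ', hψ, hψ', hD⟩ := exists_universal_opposite_cells hK A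
  obtain ⟨D', q, h, hq⟩ := exists_quotient hK D
    [⟨_, vcomp φ ψ, idc (T.toMonad.map f ≫ D.a)⟩, ⟨_, vcomp ψ φ, idc (A.a ≫ f)⟩,
      ⟨_, pre (T.toMonad.η.app A.A) φ, idc f⟩,
      ⟨_, pre (T.toMonad.μ.app A.A) φ, vcomp (post (T.cell φ) D.a) (pre (T.toMonad.map A.a) φ)⟩]
  have hμ {B : T.AlgS} (v : D ⟶ B) :
      post (vcomp (post (T.cell φ) D.a) (pre (T.toMonad.map A.a) φ)) v.f =
        vcomp (post (T.cell (post φ v.f)) B.a) (pre (T.toMonad.map A.a) (post φ v.f)) := by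
    rw [post_vcomp (by rw [post_tgt, cell_tgt, pre_src, hφ, hφ', Functor.map_comp, Category.assoc]),
      post_post, ← v.h, cell_post, post_post, pre_post]
  simp only [List.forall_mem_cons, List.not_mem_nil, false_implies, implies_true, and_true,
    hμ, post_vcomp (hφ'.trans hψ.symm), post_vcomp (hψ'.trans hφ.symm), post_idc, map_comp_a,
    ← pre_post, Category.assoc] at h hq
  obtain ⟨h₁, h₂, h₃, h₄⟩ := h
  obtain ⟨p, hp, hp'⟩ := PseudoHom.exists_of_cell (A := A) (B := D') (f ≫ q.f) (post φ q.f)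
    (by rw [post_src, hφ, Category.assoc, map_comp_a]) (by rw [post_tgt, hφ', Category.assoc])
    (invertible_iff.2 ⟨post ψ q.f, by rw [post_src, post_tgt, hψ, hφ'],
      by rw [post_src, post_tgt, hψ', hφ],
      h₁.trans (by rw [post_src, hφ, Category.assoc, map_comp_a]),
      h₂.trans (by rw [post_tgt, hφ', Category.assoc])⟩) h₃ h₄
  refine ⟨D', p, fun {B} y => ?_⟩
  obtain ⟨v, ⟨hv₁, hv₂, hv₃⟩, hv⟩ := hD y.f y.cell y.invCell rfl rfl rfl rfl
  obtain ⟨w, rfl, hw⟩ := hq v (by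
    rw [hv₁, hv₂, hv₃]
    exact ⟨y.cell_invCell, y.invCell_cell, y.pre_η_cell, y.pre_μ_cell⟩)
  refine ⟨w, PseudoHom.ext_cell ?_ ?_, fun z hz => hw z (hv _ ?_)⟩
  · rw [PseudoHom.compStrict_f, hp, ← hv₁]
    exact comp_comp_f _ _ _
  · rw [PseudoHom.compStrict_cell, hp', ← hv₂]
    exact post_post _ _ _
  · have e₁ : f ≫ (q ≫ z).f = y.f := by
      rw [← comp_comp_f, ← hp]
      exact congrArg PseudoHom.f hz
    have e₂ : post φ (q ≫ z).f = y.cell := by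
      refine (post_post _ _ _).symm.trans ?_
      rw [← hp', ← PseudoHom.compStrict_cell, hz]
    refine ⟨e₁, e₂, eq_of_inverse (c := y.cell) ?_ rfl ?_ y.cell_invCell⟩
    · rw [← e₂, post_tgt, post_src, hψ', hφ]
    · have := congrArg (post · z.f) h₂
      rw [post_vcomp (by rw [post_tgt, post_src, hψ', hφ]), post_post, post_post] at this
      refine (congrArg (vcomp _) e₂.symm).trans (this.trans ?_)
      rw [post_idc, post_src, hψ, Category.assoc, Category.assoc, Category.assoc]
      rfl

end TwoMonad

/-! ### The pseudomorphism classifier -/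

namespace TwoMonad

open Cell

variable {K : Type u} [Bicategory.{w, w} K] [Bicategory.Strict K] {T : TwoMonad K}

lemma PseudoHom.compStrict_comp {A B C D : T.AlgS} (p : PseudoHom A B) (u : B ⟶ C) (v : C ⟶ D) :
    p.compStrict (u ≫ v) = (p.compStrict u).compStrict v :=
  PseudoHom.ext_cell (comp_comp_f _ _ _).symm (by
    rw [compStrict_cell, compStrict_cell, compStrict_cell, post_post]
    rfl)

lemma PseudoHom.compStrict_id {A B : T.AlgS} (p : PseudoHom A B) : p.compStrict (𝟙 B) = p :=
  PseudoHom.ext_cell (Category.comp_id _) (by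
    rw [compStrict_cell]
    exact post_id _)

lemma PseudoHom.invCell_ofStrict {A B : T.AlgS} (u : A ⟶ B) :
    (PseudoHom.ofStrict u).invCell = idc (A.a ≫ u.f) := by
  refine eq_of_inverse (c := (PseudoHom.ofStrict u).cell) rfl rfl (PseudoHom.invCell_cell _) ?_
  rw [ofStrict_cell]
  exact vcomp_idc _ _

section

variable {Q : Prop} {A B L E : T.AlgS} {p : PseudoHom A B} {u : L ⟶ A} {v : L ⟶ B}
  {c : Cell L.A B.A}

/-- Pseudo `T`-morphisms into the comma object of a pseudo `T`-morphism are determined by their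
composites with the projections and with the universal 2-cell. -/
lemma pseudoHom_ext_of_isComma (hK : HasArrowTensors K) (hc : IsComma Q p.f u.f c)
    (hv : c.tgt = v.f) {k k' : PseudoHom E L} (h₁ : k.compStrict u = k'.compStrict u)
    (h₂ : k.compStrict v = k'.compStrict v) (h₃ : pre k.f c = pre k'.f c) : k = k' := by
  have hf : k.f = k'.f := hc.hom_ext (congrArg PseudoHom.f h₁) h₃
  refine PseudoHom.ext_cell hf (hc.cell_ext hK ?_ ?_ ?_ ?_)
  · rw [PseudoHom.cell_src, PseudoHom.cell_src, hf]
  · rw [PseudoHom.cell_tgt, PseudoHom.cell_tgt, hf]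
  · rw [← PseudoHom.compStrict_cell, h₁, PseudoHom.compStrict_cell]
  · rw [hv, ← PseudoHom.compStrict_cell, h₂, PseudoHom.compStrict_cell]

end

section

variable {A D B L : T.AlgS} {s : L ⟶ B} {c : Cell L.A B.A}

/-- A 2-cell between strict morphisms that is compatible with the actions corresponds to a strict
morphism into the cotensor with the arrow category. -/
lemma exists_strictHom_cotensor (hc : IsComma False (𝟙 B.A) s.f c)
    (hL : pre L.a c = post (T.cell c) B.a) (u : D ⟶ B) (φ : Cell D.A B.A) (hs : φ.src = u.f)
    (hφ : pre D.a φ = post (T.cell φ) B.a) : ∃ w : D ⟶ L, w ≫ s = u ∧ pre w.f c = φ := by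
  obtain ⟨w, hw, hw'⟩ := hc.exists_lift u.f φ (by rw [hs]; exact (Category.comp_id _).symm)
    False.elim
  refine ⟨⟨w, hc.hom_ext ?_ ?_⟩, Monad.Algebra.Hom.ext hw, hw'⟩
  · rw [Category.assoc, Category.assoc, hw, ← s.h, ← u.h, ← hw, Functor.map_comp, Category.assoc]
  · rw [← pre_pre, hL, ← pre_pre, hw', hφ, pre_post, ← cell_pre, hw']

/-- The universal 2-cell of the cotensor with the arrow category is a `T`-transformation between
strict morphisms, hence so is its whiskering with a strict morphism. -/
lemma pre_strictHom_cotensor (w : D ⟶ L) (hL : pre L.a c = post (T.cell c) B.a) :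
    pre D.a (pre w.f c) = post (T.cell (pre w.f c)) B.a := by
  rw [pre_pre, ← w.h, ← pre_pre, hL, pre_post, cell_pre]

lemma exists_strict_transformation {u v : D ⟶ B} (φ : Cell D.A B.A) (hs : φ.src = u.f)
    (ht : φ.tgt = v.f) (hφ : pre D.a φ = post (T.cell φ) B.a) :
    ∃ α : (PseudoHom.ofStrict u) ⟶ (PseudoHom.ofStrict v), of (Transformation.cell α) = φ := by
  refine exists_transformation φ hs ht ?_
  rw [PseudoHom.ofStrict_cell, PseudoHom.ofStrict_cell, vcomp_idc, idc_vcomp (by rw [pre_src, hs]),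
    hφ]

lemma strict_transformation_comm {u v : D ⟶ B}
    (α : (PseudoHom.ofStrict u) ⟶ (PseudoHom.ofStrict v)) :
    pre D.a (of (Transformation.cell α)) = post (T.cell (of (Transformation.cell α))) B.a := by
  have := transformation_comm α
  rwa [PseudoHom.ofStrict_cell, PseudoHom.ofStrict_cell, vcomp_idc, idc_vcomp (by rfl), eq_comm]
    at this

end

/-- The two-dimensional universal property of a classifier for pseudomorphisms follows from the
one-dimensional one, applied to cotensors with the arrow category. -/
lemma exists_pseudoClassifier [HasFiniteLimits K] (hK : HasArrowTensors K)
    (hK' : HasArrowCotensors K) {A D : T.AlgS} (p : PseudoHom A D)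
    (hp : ∀ {B : T.AlgS} (y : PseudoHom A B), ∃! v : D ⟶ B, p.compStrict v = y) :
    Nonempty (PseudoClassifier A) := by
  refine ⟨⟨D, p, fun B => ?_⟩⟩
  obtain ⟨L, s, t, c, hc, ht, hL⟩ := exists_commaAlgebra hK' False (PseudoHom.ofStrict (𝟙 B))
  have hcs : c.src = s.f := hc.src.trans (Category.comp_id _)
  have hLc : pre L.a c = post (T.cell c) B.a := by
    rw [hL, PseudoHom.invCell_ofStrict, pre_idc, idc_vcomp]
    rw [post_src, cell_src, hcs]
    exact congrArg (T.toMonad.map s.f ≫ ·) (Category.comp_id B.a)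
  refine ⟨⟨fun {u v} θ => ?_⟩, ⟨fun {u v α β} h => ?_⟩, fun u v h => (hp _).unique h rfl,
    fun y => (hp y).exists⟩
  -- fullness: a transformation is a pseudo `T`-morphism into the cotensor, so it factors
  -- through `D`
  · change D ⟶ B at u v
    change p.compStrict u ⟶ p.compStrict v at θ
    have e : vcomp (post (T.cell (of θ.cell)) B.a) (p.compStrict v).cell =
        vcomp (vcomp (pre (T.toMonad.map (p.compStrict u).f) (PseudoHom.ofStrict (𝟙 B)).cell)
          (post (p.compStrict u).cell (PseudoHom.ofStrict (𝟙 B)).f)) (pre A.a (of θ.cell)) := by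
      have h₁ : post (p.compStrict u).cell (PseudoHom.ofStrict (𝟙 B)).f = (p.compStrict u).cell :=
        post_id _
      rw [h₁, PseudoHom.ofStrict_cell, pre_idc, idc_vcomp]
      · exact transformation_comm θ
      · exact congrArg (T.toMonad.map (p.compStrict u).f ≫ ·) (Category.comp_id B.a)
    obtain ⟨k, hku, hkv, hkc⟩ := exists_pseudoHom_commaAlgebra hK hc ht hL (p.compStrict u)
      (p.compStrict v) (of θ.cell) (Category.comp_id _).symm rfl False.elim e
    obtain ⟨w, rfl, -⟩ := hp k
    have hwu : w ≫ s = u := (hp _).unique ((p.compStrict_comp w s).trans hku) rfl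
    have hwv : w ≫ t = v := (hp _).unique ((p.compStrict_comp w t).trans hkv) rfl
    obtain ⟨α, hα⟩ := exists_strict_transformation (u := u) (v := v) (pre w.f c)
      (by rw [pre_src, hcs, ← hwu]; rfl) (by rw [pre_tgt, ht, ← hwv]; rfl)
      (pre_strictHom_cotensor w hLc)
    refine ⟨⟨α⟩, Transformation.ext (of_injective (Eq.trans ?_ hkc))⟩
    refine Eq.trans (congrArg (pre p.f) hα) ?_
    exact pre_pre _ _ _
  -- faithfulness: strict morphisms into the cotensor are determined by their composite with `p`
  · change D ⟶ B at u v
    obtain ⟨wα, hα, hα'⟩ := exists_strictHom_cotensor hc hLc u (of α.hom.cell) rfl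
      (strict_transformation_comm α.hom)
    obtain ⟨wβ, hβ, hβ'⟩ := exists_strictHom_cotensor hc hLc u (of β.hom.cell) rfl
      (strict_transformation_comm β.hom)
    have hα'' : wα ≫ t = v := Monad.Algebra.Hom.ext
      ((congrArg (wα.f ≫ ·) ht.symm).trans (congrArg Cell.tgt hα'))
    have hβ'' : wβ ≫ t = v := Monad.Algebra.Hom.ext
      ((congrArg (wβ.f ≫ ·) ht.symm).trans (congrArg Cell.tgt hβ'))
    have h' : pre p.f (of α.hom.cell) = pre p.f (of β.hom.cell) :=
      congrArg (fun x : p.compStrict u ⟶ p.compStrict v => of x.cell) h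
    have hw : p.compStrict wα = p.compStrict wβ := by
      refine pseudoHom_ext_of_isComma hK hc ht ?_ ?_ ?_
      · rw [← PseudoHom.compStrict_comp, ← PseudoHom.compStrict_comp, hα, hβ]
      · rw [← PseudoHom.compStrict_comp, ← PseudoHom.compStrict_comp, hα'', hβ'']
      · rw [PseudoHom.compStrict_f, PseudoHom.compStrict_f, ← pre_pre, ← pre_pre, hα', hβ', h']
    obtain rfl := (hp _).unique hw rfl
    exact InducedCategory.hom_ext (Transformation.ext (of_injective (hα'.symm.trans hβ')))

end TwoMonad

/-! ### Trivial fibrations and cofibrant algebras -/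

section

variable {K : Type u} [Bicategory.{w, w} K]

/-- Composition with an equivalence is an equivalence of hom-categories. -/
lemma twoCatEquivalences.isEquivalence_postcomp {A B : K} {f : A ⟶ B} {g : B ⟶ A}
    (h : Nonempty (f ≫ g ≅ 𝟙 A)) (h' : Nonempty (g ≫ f ≅ 𝟙 B)) (X : K) :
    (postcomp X f).IsEquivalence := by
  obtain ⟨i⟩ := h
  obtain ⟨j⟩ := h'
  exact (CategoryTheory.Equivalence.mk (postcomp X f) (postcomp X g)
    ((rightUnitorNatIso X A).symm ≪≫ (postcomposing X A A).mapIso i.symm ≪≫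
      (associatorNatIsoLeft X f g).symm)
    (associatorNatIsoLeft X g f ≪≫ (postcomposing X B B).mapIso j ≪≫
      rightUnitorNatIso X B)).isEquivalence_functor

variable [Bicategory.Strict K]

/-- An equivalence with a strict section is an isofibration. -/
lemma twoCatIsofibrations_of_section {A B : K} {f : A ⟶ B} {s : B ⟶ A} (hs : s ≫ f = 𝟙 B)
    (h : Nonempty (f ≫ s ≅ 𝟙 A)) : twoCatIsofibrations K f := by
  intro X a b β
  have := twoCatEquivalences.isEquivalence_postcomp h ⟨eqToIso hs⟩ X
  have hb : (b ≫ s) ≫ f = b := by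
    rw [Category.assoc, hs]
    exact Category.comp_id b
  exact ⟨b ≫ s, (postcomp X f).preimageIso (eqToIso hb ≪≫ β), hb,
    (postcomp X f).map_preimage _⟩

/-- An isofibration that is an equivalence has a strict section: lift the isomorphism from the
identity to `g ≫ f`, for a pseudo-inverse `g`. -/
lemma exists_section_of_isofibration {A B : K} {f : A ⟶ B} (h : twoCatIsofibrations K f)
    (h' : twoCatEquivalences K f) : ∃ s : B ⟶ A, s ≫ f = 𝟙 B := by
  obtain ⟨g, -, ⟨i⟩⟩ := h'
  obtain ⟨s, -, hs, -⟩ := h B g (𝟙 B) i.symm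
  exact ⟨s, hs⟩

end

namespace Cell

variable {K : Type u} [Bicategory.{w, w} K] [Bicategory.Strict K]

/-- Whiskering with an equivalence is full. -/
lemma exists_post_eq {A B : K} {f : A ⟶ B} (hf : twoCatEquivalences K f) {X : K} {s t : X ⟶ A}
    {c : Cell X B} (hs : c.src = s ≫ f) (ht : c.tgt = t ≫ f) :
    ∃ d : Cell X A, d.src = s ∧ d.tgt = t ∧ post d f = c := by
  obtain ⟨g, h, h'⟩ := hf
  have := twoCatEquivalences.isEquivalence_postcomp h h' X
  obtain ⟨α, rfl⟩ := exists_eq_of c hs ht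
  exact ⟨of ((postcomp X f).preimage α), rfl, rfl, congrArg of ((postcomp X f).map_preimage α)⟩

/-- Whiskering with an equivalence is faithful. -/
lemma post_injective {A B : K} {f : A ⟶ B} (hf : twoCatEquivalences K f) {X : K} {c d : Cell X A}
    (hs : c.src = d.src) (ht : c.tgt = d.tgt) (h : post c f = post d f) : c = d := by
  obtain ⟨g, h₁, h₂⟩ := hf
  have := twoCatEquivalences.isEquivalence_postcomp h₁ h₂ X
  obtain ⟨α, rfl⟩ := exists_eq_of c hs ht
  obtain ⟨s, t, β⟩ := d
  exact congrArg of ((postcomp X f).map_injective (of_injective h))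

lemma invertible_of_post {A B : K} {f : A ⟶ B} (hf : twoCatEquivalences K f) {X : K} {c : Cell X A}
    (h : (post c f).Invertible) : c.Invertible := by
  obtain ⟨g, h₁, h₂⟩ := hf
  have := twoCatEquivalences.isEquivalence_postcomp h₁ h₂ X
  have : IsIso ((postcomp X f).map c.hom) := h
  exact isIso_of_reflects_iso c.hom (postcomp X f)

end Cell

namespace TwoMonad

open Cell

variable {K : Type u} [Bicategory.{w, w} K] [Bicategory.Strict K] {T : TwoMonad K}

/-- Pseudo `T`-morphisms lift along trivial fibrations: a section of the underlying 1-cell lifts the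
1-cell, and full faithfulness of whiskering lifts the structure 2-cell. -/
lemma exists_pseudoHom_lift {A B E : T.AlgS} (g : PseudoHom A B) (f : E ⟶ B)
    (h : twoCatIsofibrations K f.f) (h' : twoCatEquivalences K f.f) :
    ∃ k : PseudoHom A E, k.compStrict f = g := by
  obtain ⟨s, hs⟩ := exists_section_of_isofibration h h'
  have hg : (g.f ≫ s) ≫ f.f = g.f := by
    rw [Category.assoc, hs]
    exact Category.comp_id _
  have hgT : (T.toMonad.map (g.f ≫ s) ≫ E.a) ≫ f.f = T.toMonad.map g.f ≫ B.a := by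
    rw [Category.assoc, map_comp_a, hg]
  generalize g.f ≫ s = k at hg hgT
  obtain ⟨γ, h₁, h₂, h₃⟩ := exists_post_eq h' (c := g.cell) hgT.symm
    (t := A.a ≫ k) (by rw [Category.assoc, hg, PseudoHom.cell_tgt])
  have e : T.toMonad.map γ.tgt ≫ E.a = T.toMonad.map A.a ≫ γ.src := by
    rw [h₁, h₂]
    exact pseudo_mul_aux₂ (A := A) (B := E) k
  obtain ⟨k', rfl, hk⟩ := PseudoHom.exists_of_cell (A := A) (B := E) k γ h₁ h₂
    (invertible_of_post h' (by rw [h₃]; exact g.invertible_cell))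
    (by
      apply post_injective h'
      · rw [pre_src, h₁]
        exact E.eta_map_a k
      · rw [pre_tgt, h₂]
        exact A.unit_assoc k
      · rw [← pre_post, h₃, PseudoHom.pre_η_cell, post_idc, hg])
    (by
      apply post_injective h'
      · rw [pre_src, vcomp_src, post_src, cell_src, h₁]
        exact pseudo_mul_aux₁ k
      · rw [vcomp_tgt e, pre_tgt, pre_tgt, h₂]
        exact (pseudo_mul_aux₃ k).symm
      · rw [← pre_post, h₃, PseudoHom.pre_μ_cell, post_vcomp e, post_post, ← f.h, ← post_post,
          ← cell_post, ← pre_post, h₃])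
  exact ⟨k', PseudoHom.ext_cell hg (by rw [PseudoHom.compStrict_cell, hk, h₃])⟩

namespace PseudoClassifier

variable {A : T.AlgS} (C : PseudoClassifier A)

lemma hom_ext {B : T.AlgS} {u v : C.obj ⟶ B} (h : C.unit.compStrict u = C.unit.compStrict v) :
    u = v := (C.isIso B).2.2.injective h

lemma exists_hom {B : T.AlgS} (y : PseudoHom A B) :
    ∃ u : C.obj ⟶ B, C.unit.compStrict u = y := (C.isIso B).2.2.surjective y

lemma unit_f_counit_f : C.unit.f ≫ C.counit.f = 𝟙 A.A := congrArg PseudoHom.f C.unit_counit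

/-- The unit `A ⇝ A'` is a pseudo-inverse of the counit: the universal property of `A'`, applied to
the pseudolimit of the unit, provides an isomorphism `q ≫ p ≅ 𝟙`. -/
lemma counit_f_unit_f [HasFiniteLimits K] (hK : HasArrowTensors K) (hK' : HasArrowCotensors K) :
    Nonempty (C.counit.f ≫ C.unit.f ≅ 𝟙 C.obj.A) := by
  obtain ⟨L, u, v, c, hc, hv, hL⟩ := exists_commaAlgebra hK' True C.unit
  obtain ⟨k, hku, hkv, -⟩ := exists_pseudoHom_commaAlgebra hK hc hv hL
    (PseudoHom.ofStrict (𝟙 A)) C.unit (idc C.unit.f) (Category.id_comp _).symm rfl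
    (fun _ => invertible_idc _) (by
      have h₁ : pre (T.toMonad.map (PseudoHom.ofStrict (𝟙 A)).f) C.unit.cell = C.unit.cell :=
        (congrArg (pre · C.unit.cell) (T.toMonad.map_id A.A)).trans (pre_id _)
      rw [h₁, cell_idc, post_idc, pre_idc, PseudoHom.ofStrict_cell, post_idc, vcomp_idc, vcomp_idc]
      exact idc_vcomp rfl)
  obtain ⟨d, rfl⟩ := C.exists_hom k
  have hdu : d ≫ u = C.counit := C.hom_ext (by
    rw [C.unit_counit, ← hku, PseudoHom.compStrict_comp])
  have hdv : d ≫ v = 𝟙 C.obj := C.hom_ext (by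
    rw [PseudoHom.compStrict_comp, hkv, PseudoHom.compStrict_id])
  have hs : (pre d.f c).src = C.counit.f ≫ C.unit.f := by
    rw [← hdu, pre_src, hc.src]
    exact (Category.assoc _ _ _).symm
  have ht : (pre d.f c).tgt = 𝟙 C.obj.A := by
    rw [pre_tgt, hv]
    exact congrArg Monad.Algebra.Hom.f hdv
  have hi : (pre d.f c).Invertible := (hc.invertible trivial).pre _
  obtain ⟨α, hα⟩ := exists_eq_of _ hs ht
  rw [hα] at hi
  have : IsIso α := hi
  exact ⟨asIso α⟩

lemma trivialFibrations_counit [HasFiniteLimits K] (hK : HasArrowTensors K)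
    (hK' : HasArrowCotensors K) : trivialFibrations T.AlgS C.counit :=
  ⟨twoCatIsofibrations_of_section C.unit_f_counit_f (C.counit_f_unit_f hK hK'),
    C.unit.f, C.counit_f_unit_f hK hK', ⟨eqToIso C.unit_f_counit_f⟩⟩

end PseudoClassifier

/-- As the initial object imposes no condition, cofibrancy is lifting along trivial fibrations. -/
lemma isCofibrant_iff_lifting [HasInitial K] {A : T.AlgS} : IsCofibrant A ↔
    ∀ {E B : T.AlgS} (f : E ⟶ B) (v : A ⟶ B), trivialFibrations T.AlgS f →
      ∃ w : A ⟶ E, w ≫ f = v := by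
  refine (cofibration_iff _).trans ?_
  constructor
  · intro h E B f v hf
    have sq : CommSq (initial.to E) (initial.to A) f v := ⟨initialIsInitial.hom_ext _ _⟩
    have := (h f hf).sq_hasLift sq
    exact ⟨sq.lift, sq.fac_right⟩
  · intro h E B f hf
    refine ⟨fun {i v} sq => ?_⟩
    obtain ⟨w, hw⟩ := h f v hf
    exact ⟨⟨⟨w, initialIsInitial.hom_ext _ _, hw⟩⟩⟩

/-- Strict morphisms out of `A'` are pseudo `T`-morphisms out of `A`, which lift along trivial
fibrations. -/
lemma PseudoClassifier.isCofibrant [HasInitial K] {A : T.AlgS} (C : PseudoClassifier A) :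
    IsCofibrant C.obj := by
  rw [isCofibrant_iff_lifting]
  intro E B f v hf
  obtain ⟨k, hk⟩ := exists_pseudoHom_lift (C.unit.compStrict v) f hf.1 hf.2
  obtain ⟨w, rfl⟩ := C.exists_hom k
  exact ⟨w, C.hom_ext ((C.unit.compStrict_comp w f).trans hk)⟩

/-- A flexible algebra `A` is a retract of the cofibrant algebra `A'`. -/
lemma IsFlexible.isCofibrant [HasInitial K] {A : T.AlgS} (h : IsFlexible A) : IsCofibrant A := by
  obtain ⟨C, r, hr⟩ := h
  rw [isCofibrant_iff_lifting]
  intro E B f v hf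
  obtain ⟨w, hw⟩ := isCofibrant_iff_lifting.1 C.isCofibrant f (C.counit ≫ v) hf
  exact ⟨r ≫ w, by rw [Category.assoc, hw, reassoc_of% hr]⟩

lemma PseudoClassifier.isFlexible [HasInitial K] [HasFiniteLimits K] (hK : HasArrowTensors K)
    (hK' : HasArrowCotensors K) {A : T.AlgS} (C : PseudoClassifier A) (h : IsCofibrant A) :
    IsFlexible A := by
  obtain ⟨r, hr⟩ :=
    isCofibrant_iff_lifting.1 h C.counit (𝟙 A) (C.trivialFibrations_counit hK hK')
  exact ⟨C, r, hr⟩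

/-- A free algebra lifts along trivial fibrations because they have sections in `K`. -/
lemma isCofibrant_freeAlg [HasInitial K] (X : K) : IsCofibrant (T.freeAlg X) := by
  rw [isCofibrant_iff_lifting]
  intro E B f v hf
  obtain ⟨s, hs⟩ := exists_section_of_isofibration hf.1 hf.2
  refine ⟨(T.toMonad.adj.homEquiv X E).symm (T.toMonad.adj.homEquiv X B v ≫ s), ?_⟩
  apply (T.toMonad.adj.homEquiv X B).injective
  rw [Adjunction.homEquiv_naturality_right, Equiv.apply_symm_apply]
  refine (Category.assoc _ _ _).trans ?_
  exact (congrArg (T.toMonad.adj.homEquiv X B v ≫ ·) hs).trans (Category.comp_id _)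

/-- The left 2-adjoint of the inclusion of strict into pseudo `T`-morphisms is defined
everywhere. -/
lemma nonempty_pseudoClassifier [IsLocallyPresentableTwoCategory K] [HasFiniteLimits K]
    (hT : T.HasRank) (A : T.AlgS) : Nonempty (PseudoClassifier A) := by
  have hK := IsLocallyPresentableTwoCategory.hasArrowTensors (K := K)
  have := IsLocallyPresentableTwoCategory.isLocallyPresentable (K := K)
  obtain ⟨κ, _, h⟩ := CategoryTheory.IsLocallyPresentable.exists_cardinal.{w} K
  have : HasColimitsOfSize.{w, w} K := h.toHasColimitsOfSize
  have : HasColimitsOfSize.{0, 0} K := hasColimitsOfSizeShrink.{0, 0, w, w} K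
  have : HasColimitsOfSize.{w, w} T.AlgS := Monad.hasColimitsOfSize_algebra T.toMonad hT
  have : HasColimitsOfSize.{0, 0} T.AlgS := hasColimitsOfSizeShrink.{0, 0, w, w} _
  obtain ⟨D, p, hp⟩ := exists_universal_pseudoHom hK A
  exact exists_pseudoClassifier hK IsLocallyPresentableTwoCategory.hasArrowCotensors p hp

end TwoMonad

/-- Cofibrant objects of the lifted model structure on `T-Alg_s` are the flexible algebras; every
`A'` exists and is a cofibrant replacement of `A` via `q`; and free algebras are flexible. -/
theorem mainTheorem3 {K : Type u} [Bicategory.{w, w} K] [Bicategory.Strict K]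
    [IsLocallyPresentableTwoCategory K] (T : TwoMonad K) (hT : T.HasRank) :
    (∀ A : T.AlgS, IsCofibrant A ↔ TwoMonad.IsFlexible A) ∧
    (∀ A : T.AlgS, Nonempty (TwoMonad.PseudoClassifier A) ∧
      ∀ A' : TwoMonad.PseudoClassifier A,
        IsCofibrant A'.obj ∧ Fibration A'.counit ∧ WeakEquivalence A'.counit) ∧
    (∀ X : K, TwoMonad.IsFlexible (T.freeAlg X)) := by
  have hK := IsLocallyPresentableTwoCategory.hasArrowTensors (K := K)
  have hK' := IsLocallyPresentableTwoCategory.hasArrowCotensors (K := K)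
  have := IsLocallyPresentableTwoCategory.isLocallyPresentable (K := K)
  have := hasLimitsOfSize_of_isLocallyPresentable K
  have : HasLimitsOfSize.{0, 0} K := hasLimitsOfSizeShrink.{0, 0, w, w} K
  have key (A : T.AlgS) (h : IsCofibrant A) : TwoMonad.IsFlexible A := by
    obtain ⟨C⟩ := TwoMonad.nonempty_pseudoClassifier hT A
    exact C.isFlexible hK hK' h
  refine ⟨fun A => ⟨key A, fun h => h.isCofibrant⟩, fun A =>
    ⟨TwoMonad.nonempty_pseudoClassifier hT A, fun A' => ⟨A'.isCofibrant, ?_⟩⟩,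
    fun X => key _ (TwoMonad.isCofibrant_freeAlg X)⟩
  rw [← mem_trivialFibrations_iff]
  exact A'.trivialFibrations_counit hK hK'
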